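/- **Theorem.** Fix $a,g>0$. Let $C^\infty(\mathbb T)$ be the class of smooth $2\pi$-periodic functions $f:\mathbb R\to\mathbb R$ with its usual topology (uniform convergence of all derivatives), and put $$H_af(x)=\mathrm{P.V.}\int_{\mathbb R} f(x-y)K_a(y)\,dy=\lim_{\varepsilon\to0^+}\int_{|y|>\varepsilon} f(x-y)K_a(y)\,dy,\qquad K_a(y)=\frac{1}{\pi y}\,\frac{a^2}{y^2+a^2}.$$ Then the 1D IPM model $$\partial_t\rho+u\,\partial_x\rho=0,\qquad u=gH_a\rho,\qquad \rho(\cdot,0)=\rho_0$$ is locally well-posed in time in $C^\infty(\mathbb T)$. Here a solution on $[0,T)$ is a function $\rho(x,t)$, $2\pi$-periodic in $x$ and $C^\infty$ jointly in $(x,t)\in\mathbb R\times[0,T)$ (with one-sided time derivatives at $t=0$), which satisfies the equation pointwise. Precisely: 1. (Uniqueness) For every $T$ and every $\rho_0\in C^\infty(\mathbb T)$, any two solutions on $[0,T)$ with initial datum $\rho_0$ coincide on $[0,T)$. 2. (Local existence and continuous dependence) For every $\rho_0\in C^\infty(\mathbb T)$ there are $T>0$ and a neighbourhood $U$ of $\rho_0$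 in $C^\infty(\mathbb T)$ such that every $\sigma_0\in U$ (in particular $\rho_0$ itself) is the initial datum of a solution $\sigma$ on $[0,T)$, and the map $\sigma_0\mapsto\sigma$ is continuous on $U$: for every $\sigma_0\in U$, every $m\in\mathbb N$ and every $\varepsilon>0$ there is a neighbourhood $V$ of $\sigma_0$ such that for all $\tau_0\in U\cap V$, with solution $\tau$ on $[0,T)$, $$\sup_{0\le t<T}\ \max_{0\le j\le m}\ \sup_{x\in\mathbb R}\bigl|\partial_x^j\tau(x,t)-\partial_x^j\sigma(x,t)\bigr|\le\varepsilon .$$ -/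

import Mathlib

open MeasureTheory Filter Topology Set
open scoped ContDiff

namespace IPM

/-- The class `C^∞(𝕋)`: smooth `2π`-periodic functions on the real line. -/
structure SmoothPeriodic (f : ℝ → ℝ) : Prop where
  smooth : ContDiff ℝ ∞ f
  periodic : Function.Periodic f (2 * Real.pi)

/-- The kernel `K_a(y) = (1 / (π y)) * (a² / (y² + a²))`. -/
noncomputable def K (a y : ℝ) : ℝ := 1 / (Real.pi * y) * (a ^ 2 / (y ^ 2 + a ^ 2))

/-- The truncated convolution `∫_{|y| > ε} f(x - y) K_a(y) dy`. -/
noncomputable def truncH (a : ℝ) (f : ℝ → ℝ) (x ε : ℝ) : ℝ :=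
  ∫ y in {y : ℝ | ε < |y|}, f (x - y) * K a y

/-- `H_a f(x) = P.V. ∫_ℝ f(x - y) K_a(y) dy`, the limit of the truncated integrals as `ε → 0⁺`.
By `tendsto_truncH` below this limit exists for every `f ∈ C^∞(𝕋)`, and by
`integrableOn_truncH` the truncated integrals converge absolutely. -/
noncomputable def H (a : ℝ) (f : ℝ → ℝ) (x : ℝ) : ℝ :=
  limUnder (𝓝[>] (0 : ℝ)) (truncH a f x)

/-- `ρ` (written `ρ t x`) is a solution in `C^∞(𝕋 × [0, T))` of
`∂_t ρ + u ∂_x ρ = 0`, `u = g H_a ρ`, `ρ(·, 0) = ρ₀`.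
The time derivative at `t = 0` is the one-sided one. -/
structure IsSolution (a g T : ℝ) (ρ₀ : ℝ → ℝ) (ρ : ℝ → ℝ → ℝ) : Prop where
  smooth : ContDiffOn ℝ ∞ (fun p : ℝ × ℝ => ρ p.1 p.2) (Ico 0 T ×ˢ univ)
  periodic : ∀ t ∈ Ico 0 T, Function.Periodic (ρ t) (2 * Real.pi)
  initial : ρ 0 = ρ₀
  transport : ∀ t ∈ Ico 0 T, ∀ x : ℝ,
    HasDerivWithinAt (fun s => ρ s x) (-((g * H a (ρ t) x) * deriv (ρ t) x)) (Ico 0 T) t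

/-- `f` is within `δ` of `h` in `C^k`. As `k` and `δ > 0` vary, the sets
`{f | CkClose k δ f h}` form a neighbourhood basis of `h` in the usual topology of `C^∞(𝕋)`. -/
def CkClose (k : ℕ) (δ : ℝ) (f h : ℝ → ℝ) : Prop :=
  ∀ j ≤ k, ∀ x : ℝ, |iteratedDeriv j f x - iteratedDeriv j h x| ≤ δ

theorem integrable_bump {a : ℝ} (ha : 0 < a) : Integrable (fun y : ℝ => a ^ 2 / (y ^ 2 + a ^ 2)) := by
  have h := integrable_inv_one_add_sq.comp_div ha.ne'
  refine h.congr (Eventually.of_forall fun y => ?_)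
  have : y ^ 2 + a ^ 2 ≠ 0 := by positivity
  have : 1 + (y / a) ^ 2 ≠ 0 := by positivity
  field_simp
  ring

theorem measurable_K (a : ℝ) : Measurable (K a) := by
  unfold K; fun_prop

theorem SmoothPeriodic.exists_bound {f : ℝ → ℝ} (hf : SmoothPeriodic f) :
    ∃ M, 0 ≤ M ∧ ∀ x, |f x| ≤ M := by
  have hb := hf.periodic.isBounded_of_continuous (by positivity) hf.smooth.continuous
  obtain ⟨M, hM⟩ := hb.exists_norm_le
  exact ⟨M, (norm_nonneg _).trans (hM (f 0) ⟨0, rfl⟩), fun x => hM _ ⟨x, rfl⟩⟩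

theorem SmoothPeriodic.exists_lipschitz {f : ℝ → ℝ} (hf : SmoothPeriodic f) :
    ∃ L, 0 ≤ L ∧ ∀ x y, |f x - f y| ≤ L * |x - y| := by
  have hd : SmoothPeriodic (deriv f) := by
    refine ⟨?_, fun x => ?_⟩
    · exact ((contDiff_infty_iff_deriv).1 hf.smooth).2
    · rw [← deriv_comp_add_const, show (fun x => f (x + 2 * Real.pi)) = f from funext hf.periodic]
  obtain ⟨L, hL0, hL⟩ := hd.exists_bound
  refine ⟨L, hL0, fun x y => ?_⟩
  exact Convex.norm_image_sub_le_of_norm_deriv_le (s := univ)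
    (fun z _ => (hf.smooth.differentiable (by simp)).differentiableAt) (fun z _ => hL z)
    convex_univ (mem_univ y) (mem_univ x)

theorem abs_K_mul {a : ℝ} (ha : 0 < a) (y : ℝ) (hy : y ≠ 0) :
    |K a y| = 1 / (Real.pi * |y|) * (a ^ 2 / (y ^ 2 + a ^ 2)) := by
  unfold K
  have hp := Real.pi_pos
  rw [abs_mul, abs_div, abs_mul, abs_one, abs_of_pos hp, abs_of_nonneg (by positivity : 0 ≤ a ^ 2 / (y ^ 2 + a ^ 2))]

theorem measurableSet_trunc (ε : ℝ) : MeasurableSet {y : ℝ | ε < |y|} :=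
  measurableSet_lt measurable_const (by fun_prop)

/-- The truncated integrals converge absolutely for `f ∈ C^∞(𝕋)`. -/
theorem integrableOn_truncH {a : ℝ} (ha : 0 < a) {f : ℝ → ℝ} (hf : SmoothPeriodic f) (x : ℝ)
    {ε : ℝ} (hε : 0 < ε) :
    IntegrableOn (fun y => f (x - y) * K a y) {y : ℝ | ε < |y|} := by
  obtain ⟨M, hM0, hM⟩ := hf.exists_bound
  have hp := Real.pi_pos
  have hc := hf.smooth.continuous
  refine Integrable.mono' (((integrable_bump ha).const_mul (M * (1 / (Real.pi * ε)))).integrableOn)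
    (((by fun_prop : Continuous fun y => f (x - y)).measurable.mul
      (measurable_K a)).aestronglyMeasurable) ?_
  refine (ae_restrict_iff' (measurableSet_trunc ε)).2 (Eventually.of_forall fun y hy => ?_)
  have hy' : ε < |y| := hy
  have hy0 : y ≠ 0 := by
    rintro rfl
    simp at hy'
    linarith
  rw [Real.norm_eq_abs, abs_mul, abs_K_mul ha y hy0, mul_assoc]
  have := hM (x - y)
  gcongr

theorem truncH_eq {a : ℝ} (ha : 0 < a) {f : ℝ → ℝ} (hf : SmoothPeriodic f) (x : ℝ)
    {ε : ℝ} (hε : 0 < ε) :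
    truncH a f x ε = ∫ y in Ioi ε, (f (x - y) - f (x + y)) * K a y := by
  have hint := integrableOn_truncH ha hf x hε
  have hset : {y : ℝ | ε < |y|} = Iio (-ε) ∪ Ioi ε := by
    ext y
    simp only [mem_ofPred_eq, mem_union, mem_Iio, mem_Ioi, lt_abs]
    constructor
    · rintro (h | h)
      · exact Or.inr h
      · exact Or.inl (by linarith)
    · rintro (h | h)
      · exact Or.inr (by linarith)
      · exact Or.inl h
  unfold truncH
  rw [hset] at hint ⊢
  have h1 := hint.mono_set (subset_union_left)
  have h2 := hint.mono_set (subset_union_right)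
  have hd : Disjoint (Iio (-ε)) (Ioi ε) := by
    rw [Set.disjoint_left]
    intro y hy hy2
    simp only [mem_Iio, mem_Ioi] at hy hy2
    linarith
  have h3 : IntegrableOn (fun y => f (x + y) * K a y) (Ioi ε) := by
    have := ((Measure.measurePreserving_neg (volume : Measure ℝ)).integrableOn_comp_preimage
      (Homeomorph.neg ℝ).measurableEmbedding).2 h1
    rw [show (Neg.neg ⁻¹' Iio (-ε) : Set ℝ) = Ioi ε by ext y; simp] at this
    refine (this.neg).congr (Eventually.of_forall fun y => ?_)
    simp [K]
  rw [setIntegral_union hd measurableSet_Ioi h1 h2, ← integral_Iic_eq_integral_Iio,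
    ← integral_comp_neg_Ioi]
  simp only [sub_mul]
  rw [integral_sub h2 h3, add_comm, sub_eq_add_neg, ← integral_neg]
  congr 2
  ext y
  simp [K]

/-- The principal value exists for `f ∈ C^∞(𝕋)`, so that `H` is its genuine value. -/
theorem tendsto_truncH {a : ℝ} (ha : 0 < a) {f : ℝ → ℝ} (hf : SmoothPeriodic f) (x : ℝ) :
    Tendsto (truncH a f x) (𝓝[>] 0) (𝓝 (H a f x)) := by
  refine tendsto_nhds_limUnder ⟨∫ y in Ioi 0, (f (x - y) - f (x + y)) * K a y, ?_⟩
  obtain ⟨L, hL0, hL⟩ := hf.exists_lipschitz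
  have hp := Real.pi_pos
  have hc := hf.smooth.continuous
  have hm : Measurable fun y => (f (x - y) - f (x + y)) * K a y :=
    (by fun_prop : Continuous fun y => f (x - y) - f (x + y)).measurable.mul (measurable_K a)
  have key : Tendsto (fun ε : ℝ => ∫ y, (Ioi ε).indicator
      (fun y => (f (x - y) - f (x + y)) * K a y) y) (𝓝[>] 0)
      (𝓝 (∫ y, (Ioi 0).indicator (fun y => (f (x - y) - f (x + y)) * K a y) y)) := by
    refine tendsto_integral_filter_of_dominated_convergence
      (fun y => (2 * L / Real.pi) * (a ^ 2 / (y ^ 2 + a ^ 2))) ?_ ?_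
      ((integrable_bump ha).const_mul _) ?_
    · exact Eventually.of_forall fun ε => (hm.indicator measurableSet_Ioi).aestronglyMeasurable
    · filter_upwards [self_mem_nhdsWithin] with ε hε
      refine Eventually.of_forall fun y => ?_
      have hε' : 0 < ε := hε
      by_cases hy : y ∈ Ioi ε
      · have hy0 : 0 < y := hε'.trans hy
        rw [indicator_of_mem hy, Real.norm_eq_abs, abs_mul, abs_K_mul ha y hy0.ne',
          abs_of_pos hy0]
        have h := hL (x - y) (x + y)
        rw [show x - y - (x + y) = -(2 * y) by ring, abs_neg, abs_of_pos (by linarith : 0 < 2 * y)] at h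
        calc _ ≤ (L * (2 * y)) * (1 / (Real.pi * y) * (a ^ 2 / (y ^ 2 + a ^ 2))) := by gcongr
          _ = _ := by field_simp
      · rw [indicator_of_notMem hy, norm_zero]
        positivity
    · refine Eventually.of_forall fun y => ?_
      by_cases hy : 0 < y
      · refine tendsto_const_nhds.congr' ?_
        filter_upwards [mem_nhdsWithin_of_mem_nhds (Iio_mem_nhds hy)] with ε hε
        rw [indicator_of_mem (show y ∈ Ioi 0 from hy), indicator_of_mem (show y ∈ Ioi ε from hε)]
      · refine tendsto_const_nhds.congr' ?_
        filter_upwards [self_mem_nhdsWithin] with ε hε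
        have hε' : 0 < ε := hε
        rw [indicator_of_notMem (show y ∉ Ioi 0 from hy),
          indicator_of_notMem (show y ∉ Ioi ε from fun h => hy (hε'.trans h))]
  simp only [integral_indicator measurableSet_Ioi] at key
  refine key.congr' ?_
  filter_upwards [self_mem_nhdsWithin] with ε hε
  exact (truncH_eq ha hf x hε).symm

end IPM

/-! On the Fourier side `H_a` multiplies exp(ilx) by -i times a real odd symbol. Near 0 the kernel
behaves like the Hilbert kernel 1/(πy), and it decreases to 0 on the positive half-line, so the
symbol is bounded uniformly in l (`abs_symb_le`). The velocity is thus real and costs no derivative,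
and the equation becomes an ODE for rapidly decaying sequences, c' = `rhs` c, with a quadratic
right-hand side that loses one derivative.

The loss is recovered by the energy method. Pairing with a weight of order s, the leading term is
skew-symmetric because the velocity is real, and the commutator with the weight splits into two
products in which one factor is measured in the Wiener norm with one derivative. The resulting
bound, `abs_re_energy_vel_le`, is (constant) · `wiener` c · `sob` s c. Since `sob` 2 controls
`wiener`, a bound of order 2 on some interval propagates every higher order on the same interval.
This is why a single lifespan serves the whole smooth class.

Existence: truncate to finitely many frequencies, solve the finite systems on a common interval
(`exists_galerkin`), and take coefficientwise limits (`exists_coefficient_solution`). The sequences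
need not be hermitian: the velocity is built from the real part only, so the real part of the
limiting series solves the equation. Energy bounds are two-sided in time, hence everything is done
on (-T, T), and the one-sided smoothness at t = 0 is obtained by restriction. Time regularity is
bootstrapped from the equation (`rapidDiff_of_solution`).

Uniqueness: the coefficients of any smooth solution satisfy the same ODE
(`IsSolution.hasDerivAt_coef`), and the difference of two solutions obeys a Gronwall inequality in
L². Continuous dependence: the same estimate makes differences small in L², while all orders are
bounded uniformly for nearby data, so interpolation gives smallness in every C^m. -/

namespace IPM

/-! ### Weighted sequences -/

/-- The weight `⟨k⟩ = 1 + |k|`. -/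
noncomputable def wt (k : ℤ) : ℝ := 1 + |(k : ℝ)|

theorem one_le_wt (k : ℤ) : 1 ≤ wt k := by
  unfold wt; linarith [abs_nonneg (k : ℝ)]

theorem wt_pos (k : ℤ) : 0 < wt k := zero_lt_one.trans_le (one_le_wt k)

theorem wt_neg (k : ℤ) : wt (-k) = wt k := by simp [wt]

theorem abs_le_wt (k : ℤ) : |(k : ℝ)| ≤ wt k := by unfold wt; linarith

/-- Peetre-type inequality; it lets a weight at the output frequency of a convolution be shared
between the two input frequencies. -/
theorem wt_le_mul (k j : ℤ) : wt k ≤ wt (k - j) * wt j := by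
  unfold wt
  have h : |(k : ℝ)| ≤ |((k - j : ℤ) : ℝ)| + |(j : ℝ)| := by
    have := abs_add_le ((k - j : ℤ) : ℝ) (j : ℝ)
    simpa using this
  nlinarith [abs_nonneg ((k - j : ℤ) : ℝ), abs_nonneg (j : ℝ),
    mul_nonneg (abs_nonneg ((k - j : ℤ) : ℝ)) (abs_nonneg (j : ℝ))]

theorem one_le_wt_pow (p : ℕ) (k : ℤ) : 1 ≤ wt k ^ p := one_le_pow₀ (one_le_wt k)

theorem summable_inv_wt_sq : Summable fun k : ℤ => (wt k ^ 2)⁻¹ := by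
  have h : Summable fun n : ℕ => (((n : ℝ) + 1) ^ 2)⁻¹ := by
    have := (summable_nat_add_iff 1).2 (Real.summable_nat_pow_inv (p := 2) |>.2 (by norm_num))
    simpa using this
  refine Summable.of_nat_of_neg ?_ ?_ <;>
  · refine h.congr fun n => ?_
    simp [wt, add_comm]

/-- The sum of `⟨k⟩⁻²`. -/
noncomputable def wtSum : ℝ := ∑' k : ℤ, (wt k ^ 2)⁻¹

theorem wtSum_nonneg : 0 ≤ wtSum := tsum_nonneg fun k => by have := wt_pos k; positivity

/-- `‖c k‖ ≤ M ⟨k⟩^{-p}` for all `k`. -/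
def Decay (p : ℕ) (M : ℝ) (c : ℤ → ℂ) : Prop := ∀ k, wt k ^ p * ‖c k‖ ≤ M

theorem Decay.nonneg {p : ℕ} {M : ℝ} {c : ℤ → ℂ} (h : Decay p M c) : 0 ≤ M :=
  le_trans (by have := wt_pos 0; positivity) (h 0)

theorem Decay.mono {p q : ℕ} {M M' : ℝ} {c : ℤ → ℂ} (h : Decay p M c) (hq : q ≤ p) (hM : M ≤ M') :
    Decay q M' c := fun k =>
  (mul_le_mul_of_nonneg_right (pow_le_pow_right₀ (one_le_wt k) hq) (norm_nonneg _)).trans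
    ((h k).trans hM)

theorem Decay.weight_le {p : ℕ} {M : ℝ} {c : ℤ → ℂ} (h : Decay (p + 2) M c) (k : ℤ) :
    wt k ^ p * ‖c k‖ ≤ M * (wt k ^ 2)⁻¹ := by
  have := wt_pos k
  rw [← div_eq_mul_inv, le_div_iff₀ (by positivity)]
  have := h k
  rw [pow_add] at this
  linarith

theorem Decay.summable {p : ℕ} {M : ℝ} {c : ℤ → ℂ} (h : Decay (p + 2) M c) :
    Summable fun k => wt k ^ p * ‖c k‖ :=
  Summable.of_nonneg_of_le (fun k => by have := wt_pos k; positivity) h.weight_le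
    (summable_inv_wt_sq.mul_left M)

theorem Decay.tsum_le {p : ℕ} {M : ℝ} {c : ℤ → ℂ} (h : Decay (p + 2) M c) :
    ∑' k, wt k ^ p * ‖c k‖ ≤ M * wtSum := by
  unfold wtSum
  rw [← tsum_mul_left]
  exact h.summable.tsum_le_tsum h.weight_le (summable_inv_wt_sq.mul_left M)

theorem Decay.add {p : ℕ} {M M' : ℝ} {c d : ℤ → ℂ} (hc : Decay p M c) (hd : Decay p M' d) :
    Decay p (M + M') (fun k => c k + d k) := fun k => by
  have := wt_pos k
  calc _ ≤ wt k ^ p * (‖c k‖ + ‖d k‖) := by gcongr; exact norm_add_le _ _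
    _ ≤ _ := by rw [mul_add]; exact add_le_add (hc k) (hd k)

theorem Decay.neg {p : ℕ} {M : ℝ} {c : ℤ → ℂ} (hc : Decay p M c) :
    Decay p M (fun k => - c k) := fun k => by simpa using hc k

theorem Decay.sub {p : ℕ} {M M' : ℝ} {c d : ℤ → ℂ} (hc : Decay p M c) (hd : Decay p M' d) :
    Decay p (M + M') (fun k => c k - d k) := by
  simpa [sub_eq_add_neg] using hc.add hd.neg

theorem Decay.mul_left {p q : ℕ} {M B : ℝ} {c m : ℤ → ℂ} (hB : 0 ≤ B) (hc : Decay (p + q) M c)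
    (hm : ∀ k, ‖m k‖ ≤ B * wt k ^ q) : Decay p (B * M) (fun k => m k * c k) := fun k => by
  have := wt_pos k
  rw [norm_mul]
  calc _ ≤ wt k ^ p * (B * wt k ^ q * ‖c k‖) := by gcongr; exact hm k
    _ = B * (wt k ^ (p + q) * ‖c k‖) := by ring
    _ ≤ _ := by gcongr; exact hc k

theorem Decay.conjReflect {p : ℕ} {M : ℝ} {c : ℤ → ℂ} (hc : Decay p M c) :
    Decay p M (fun k => starRingEnd ℂ (c (-k))) := fun k => by
  simpa [wt_neg] using hc (-k)

/-! ### Convolution, differentiation and velocity on sequences -/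

/-- The convolution of two sequences. -/
noncomputable def conv (u d : ℤ → ℂ) (k : ℤ) : ℂ := ∑' j, u (k - j) * d j

/-- After the weight is distributed, only `d` pays the two extra orders that make the sum over `j`
converge; `u` loses nothing. -/
theorem norm_conv_term_le {p : ℕ} {M M' : ℝ} {u d : ℤ → ℂ} (hu : Decay p M u)
    (hd : Decay (p + 2) M' d) (k j : ℤ) :
    wt k ^ p * ‖u (k - j) * d j‖ ≤ M * M' * (wt j ^ 2)⁻¹ := by
  have h1 := wt_pos k
  have h2 := wt_pos (k - j)
  have h3 := wt_pos j
  have := hd.nonneg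
  rw [norm_mul]
  calc _ ≤ (wt (k - j) * wt j) ^ p * (‖u (k - j)‖ * ‖d j‖) := by gcongr; exact wt_le_mul k j
    _ = (wt (k - j) ^ p * ‖u (k - j)‖) * (wt j ^ p * ‖d j‖) := by ring
    _ ≤ M * (M' * (wt j ^ 2)⁻¹) :=
        mul_le_mul (hu _) (hd.weight_le j) (by positivity) hu.nonneg
    _ = _ := by ring

theorem summable_conv {M M' : ℝ} {u d : ℤ → ℂ} (hu : Decay 0 M u) (hd : Decay 2 M' d) (k : ℤ) :
    Summable fun j => u (k - j) * d j :=
  Summable.of_norm_bounded (summable_inv_wt_sq.mul_left (M * M')) fun j => by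
    simpa using norm_conv_term_le hu hd k j

theorem Decay.conv {p : ℕ} {M M' : ℝ} {u d : ℤ → ℂ} (hu : Decay p M u) (hd : Decay (p + 2) M' d) :
    Decay p (M * M' * wtSum) (conv u d) := fun k => by
  have hs : Summable fun j => u (k - j) * d j :=
    summable_conv (hu.mono (Nat.zero_le _) le_rfl) (hd.mono (by omega) le_rfl) k
  have h1 := wt_pos k
  calc _ ≤ wt k ^ p * ∑' j, ‖u (k - j) * d j‖ := by
        gcongr; exact norm_tsum_le_tsum_norm hs.norm
    _ = ∑' j, wt k ^ p * ‖u (k - j) * d j‖ := tsum_mul_left.symm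
    _ ≤ ∑' j, M * M' * (wt j ^ 2)⁻¹ :=
        (hs.norm.mul_left _).tsum_le_tsum (norm_conv_term_le hu hd k) (summable_inv_wt_sq.mul_left _)
    _ = _ := by rw [tsum_mul_left]; rfl

/-- Multiplication by `i k`, the Fourier side of differentiation. -/
noncomputable def dx (c : ℤ → ℂ) (k : ℤ) : ℂ := Complex.I * k * c k

theorem Decay.dx {p : ℕ} {M : ℝ} {c : ℤ → ℂ} (hc : Decay (p + 1) M c) : Decay p M (dx c) := by
  have := Decay.mul_left zero_le_one hc (m := fun k => Complex.I * k) (fun k => by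
    simpa using abs_le_wt k)
  rwa [one_mul] at this

/-- A bounded hermitian Fourier multiplier. -/
structure IsMult (μ : ℤ → ℂ) (B : ℝ) : Prop where
  bound : ∀ k, ‖μ k‖ ≤ B
  herm : ∀ k, μ (-k) = starRingEnd ℂ (μ k)

theorem IsMult.nonneg {μ : ℤ → ℂ} {B : ℝ} (h : IsMult μ B) : 0 ≤ B :=
  (norm_nonneg _).trans (h.bound 0)

/-- The Fourier coefficients of the velocity generated by the real part of a function with
Fourier coefficients `c`. -/
noncomputable def vel (μ c : ℤ → ℂ) (k : ℤ) : ℂ := μ k * ((c k + starRingEnd ℂ (c (-k))) / 2)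

theorem vel_neg {μ : ℤ → ℂ} {B : ℝ} (h : IsMult μ B) (c : ℤ → ℂ) (k : ℤ) :
    vel μ c (-k) = starRingEnd ℂ (vel μ c k) := by
  simp only [vel, h.herm, map_mul, map_div₀, map_add, neg_neg, Complex.conj_conj, Complex.conj_ofNat]
  rw [add_comm]

theorem norm_vel_le {μ : ℤ → ℂ} {B : ℝ} (h : IsMult μ B) (c : ℤ → ℂ) (k : ℤ) :
    ‖vel μ c k‖ ≤ B * ((‖c k‖ + ‖c (-k)‖) / 2) := by
  unfold vel
  rw [norm_mul, norm_div]
  have := norm_add_le (c k) (starRingEnd ℂ (c (-k)))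
  have h2 := h.bound k
  have := h.nonneg
  rw [RCLike.norm_conj] at *
  norm_num
  gcongr

theorem Decay.vel {p : ℕ} {M B : ℝ} {c μ : ℤ → ℂ} (h : IsMult μ B) (hc : Decay p M c) :
    Decay p (B * M) (vel μ c) := fun k => by
  have := wt_pos k
  have h1 := hc k
  have h2 := hc (-k)
  rw [wt_neg] at h2
  calc _ ≤ wt k ^ p * (B * ((‖c k‖ + ‖c (-k)‖) / 2)) := by gcongr; exact norm_vel_le h c k
    _ = B * ((wt k ^ p * ‖c k‖ + wt k ^ p * ‖c (-k)‖) / 2) := by ring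
    _ ≤ B * M := by
      have := h.nonneg
      gcongr
      linarith

theorem vel_sub (μ c d : ℤ → ℂ) (k : ℤ) :
    vel μ (fun k => c k - d k) k = vel μ c k - vel μ d k := by
  simp [vel]; ring

theorem dx_sub (c d : ℤ → ℂ) (k : ℤ) : dx (fun k => c k - d k) k = dx c k - dx d k := by
  simp [dx]; ring

/-! ### Energy estimates -/

/-- The shear `(j, k) ↦ (j, k - j)` of `ℤ × ℤ`. -/
def shearRight : ℤ × ℤ ≃ ℤ × ℤ where
  toFun p := (p.1, p.2 - p.1)
  invFun p := (p.1, p.2 + p.1)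
  left_inv p := by simp
  right_inv p := by simp

/-- The map `(j, k) ↦ (k, k - j)` of `ℤ × ℤ`. -/
def shearLeft : ℤ × ℤ ≃ ℤ × ℤ where
  toFun p := (p.2, p.2 - p.1)
  invFun p := (p.1 - p.2, p.1)
  left_inv p := by simp
  right_inv p := by simp

theorem hasSum_shear_fst {f g : ℤ → ℝ} (hf : Summable f) (hg : Summable g) (hf0 : ∀ k, 0 ≤ f k)
    (hg0 : ∀ k, 0 ≤ g k) :
    HasSum (fun p : ℤ × ℤ => f (p.2 - p.1) * g p.1) ((∑' k, f k) * ∑' k, g k) := by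
  have h := (hg.mul_of_nonneg hf hg0 hf0).hasSum
  rw [← hg.tsum_mul_tsum hf (hg.mul_of_nonneg hf hg0 hf0), mul_comm] at h
  have := (shearRight.hasSum_iff).2 h
  refine this.congr_fun fun p => ?_
  simp [shearRight, mul_comm]

theorem hasSum_shear_snd {f g : ℤ → ℝ} (hf : Summable f) (hg : Summable g) (hf0 : ∀ k, 0 ≤ f k)
    (hg0 : ∀ k, 0 ≤ g k) :
    HasSum (fun p : ℤ × ℤ => f (p.2 - p.1) * g p.2) ((∑' k, f k) * ∑' k, g k) := by
  have h := (hg.mul_of_nonneg hf hg0 hf0).hasSum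
  rw [← hg.tsum_mul_tsum hf (hg.mul_of_nonneg hf hg0 hf0), mul_comm] at h
  have := (shearLeft.hasSum_iff).2 h
  refine this.congr_fun fun p => ?_
  simp [shearLeft, mul_comm]

/-- Young's inequality 2gh ≤ g² + h² replaces Cauchy–Schwarz; each of the two resulting double sums
factors after a shear. Here the difference frequency carries the ℓ¹ factor; in
`trilinear_summable_mid` it is the middle one. -/
theorem trilinear_summable_left {f g h : ℤ → ℝ} (hf : Summable f) (hg : Summable fun k => g k ^ 2)
    (hh : Summable fun k => h k ^ 2) (hf0 : ∀ k, 0 ≤ f k) (hg0 : ∀ k, 0 ≤ g k)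
    (hh0 : ∀ k, 0 ≤ h k) :
    Summable (fun p : ℤ × ℤ => f (p.2 - p.1) * g p.1 * h p.2) ∧
      ∑' p : ℤ × ℤ, f (p.2 - p.1) * g p.1 * h p.2 ≤
        (∑' k, f k) * (∑' k, g k ^ 2 + ∑' k, h k ^ 2) / 2 := by
  have h1 := hasSum_shear_fst hf hg hf0 (fun k => sq_nonneg _)
  have h2 := hasSum_shear_snd hf hh hf0 (fun k => sq_nonneg _)
  have h3 := (h1.add h2).div_const 2
  have hle : ∀ p : ℤ × ℤ, f (p.2 - p.1) * g p.1 * h p.2 ≤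
      (f (p.2 - p.1) * g p.1 ^ 2 + f (p.2 - p.1) * h p.2 ^ 2) / 2 := fun p => by
    nlinarith [mul_nonneg (hf0 (p.2 - p.1)) (sq_nonneg (g p.1 - h p.2))]
  have hs := Summable.of_nonneg_of_le
    (fun p => mul_nonneg (mul_nonneg (hf0 _) (hg0 _)) (hh0 _)) hle h3.summable
  refine ⟨hs, (hs.tsum_le_tsum hle h3.summable).trans_eq ?_⟩
  rw [h3.tsum_eq]
  ring

theorem trilinear_summable_mid {f g h : ℤ → ℝ} (hf : Summable fun k => f k ^ 2) (hg : Summable g)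
    (hh : Summable fun k => h k ^ 2) (hf0 : ∀ k, 0 ≤ f k) (hg0 : ∀ k, 0 ≤ g k)
    (hh0 : ∀ k, 0 ≤ h k) :
    Summable (fun p : ℤ × ℤ => f (p.2 - p.1) * g p.1 * h p.2) ∧
      ∑' p : ℤ × ℤ, f (p.2 - p.1) * g p.1 * h p.2 ≤
        (∑' k, g k) * (∑' k, f k ^ 2 + ∑' k, h k ^ 2) / 2 := by
  have h1 := hasSum_shear_fst hf hg (fun k => sq_nonneg _) hg0
  have h2 := ((hg.mul_of_nonneg hh hg0 (fun k => sq_nonneg _))).hasSum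
  rw [← hg.tsum_mul_tsum hh h2.summable] at h2
  have h3 := (h1.add h2).div_const 2
  have hle : ∀ p : ℤ × ℤ, f (p.2 - p.1) * g p.1 * h p.2 ≤
      (f (p.2 - p.1) ^ 2 * g p.1 + g p.1 * h p.2 ^ 2) / 2 := fun p => by
    nlinarith [mul_nonneg (hg0 p.1) (sq_nonneg (f (p.2 - p.1) - h p.2))]
  have hs := Summable.of_nonneg_of_le
    (fun p => mul_nonneg (mul_nonneg (hf0 _) (hg0 _)) (hh0 _)) hle h3.summable
  refine ⟨hs, (hs.tsum_le_tsum hle h3.summable).trans_eq ?_⟩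
  rw [h3.tsum_eq]
  ring

/-- The Wiener norm with one derivative. -/
noncomputable def wiener (c : ℤ → ℂ) : ℝ := ∑' k, wt k * ‖c k‖

/-- The square of the Sobolev norm of order `s`. -/
noncomputable def sob (s : ℕ) (c : ℤ → ℂ) : ℝ := ∑' k, (wt k ^ s * ‖c k‖) ^ 2

theorem wiener_nonneg (c : ℤ → ℂ) : 0 ≤ wiener c :=
  tsum_nonneg fun k => mul_nonneg (wt_pos k).le (norm_nonneg _)

theorem sob_nonneg (s : ℕ) (c : ℤ → ℂ) : 0 ≤ sob s c := tsum_nonneg fun _ => sq_nonneg _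

theorem Decay.summable_wiener {M : ℝ} {c : ℤ → ℂ} (hc : Decay 3 M c) :
    Summable fun k => wt k * ‖c k‖ := by
  simpa using Decay.summable (p := 1) hc

theorem Decay.wiener_le {M : ℝ} {c : ℤ → ℂ} (hc : Decay 3 M c) : wiener c ≤ M * wtSum := by
  simpa [wiener] using Decay.tsum_le (p := 1) hc

theorem Decay.sq_le {s : ℕ} {M : ℝ} {c : ℤ → ℂ} (hc : Decay (s + 1) M c) (k : ℤ) :
    (wt k ^ s * ‖c k‖) ^ 2 ≤ M ^ 2 * (wt k ^ 2)⁻¹ := by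
  have h := wt_pos k
  rw [← div_eq_mul_inv, le_div_iff₀ (by positivity), ← mul_pow]
  have := hc k
  rw [pow_succ] at this
  refine pow_le_pow_left₀ (by positivity) (by linarith) 2

theorem Decay.summable_sob {s : ℕ} {M : ℝ} {c : ℤ → ℂ} (hc : Decay (s + 1) M c) :
    Summable fun k => (wt k ^ s * ‖c k‖) ^ 2 :=
  Summable.of_nonneg_of_le (fun _ => sq_nonneg _) hc.sq_le (summable_inv_wt_sq.mul_left _)

theorem Decay.sob_le {s : ℕ} {M : ℝ} {c : ℤ → ℂ} (hc : Decay (s + 1) M c) :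
    sob s c ≤ M ^ 2 * wtSum := by
  unfold wtSum sob
  rw [← tsum_mul_left]
  exact hc.summable_sob.tsum_le_tsum hc.sq_le (summable_inv_wt_sq.mul_left _)

theorem summable_norm_sq {M : ℝ} {c : ℤ → ℂ} (hc : Decay 1 M c) :
    Summable fun k => ‖c k‖ ^ 2 := by
  simpa using Decay.summable_sob (s := 0) hc

theorem sob_zero (c : ℤ → ℂ) : sob 0 c = ∑' k, ‖c k‖ ^ 2 := by simp [sob]

theorem norm_dx (d : ℤ → ℂ) (j : ℤ) : ‖dx d j‖ = |(j : ℝ)| * ‖d j‖ := by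
  simp [dx]

/-- The double series behind the pairing of `e` with `u ∂ₓ d`. -/
theorem summable_pairing {Mu Md Me : ℝ} {u d e : ℤ → ℂ} (hu : Decay 3 Mu u) (hd : Decay 3 Md d)
    (he : Decay 3 Me e) :
    Summable fun p : ℤ × ℤ => starRingEnd ℂ (e p.2) * (u (p.2 - p.1) * dx d p.1) := by
  refine Summable.of_norm_bounded (trilinear_summable_mid
    (summable_norm_sq (hu.mono (by norm_num) le_rfl)) hd.summable_wiener
    (summable_norm_sq (he.mono (by norm_num) le_rfl)) (fun _ => norm_nonneg _)
    (fun k => mul_nonneg (wt_pos k).le (norm_nonneg _)) (fun _ => norm_nonneg _)).1 fun p => ?_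
  rw [norm_mul, norm_mul, RCLike.norm_conj, norm_dx, mul_comm]
  gcongr
  exact abs_le_wt _

theorem tsum_pairing {Mu Md Me : ℝ} {u d e : ℤ → ℂ} (hu : Decay 3 Mu u) (hd : Decay 3 Md d)
    (he : Decay 3 Me e) :
    ∑' k, starRingEnd ℂ (e k) * conv u (dx d) k =
      ∑' p : ℤ × ℤ, starRingEnd ℂ (e p.2) * (u (p.2 - p.1) * dx d p.1) := by
  have h := (Equiv.prodComm ℤ ℤ).summable_iff.2 (summable_pairing hu hd he)
  rw [← (Equiv.prodComm ℤ ℤ).tsum_eq]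
  have h2 := h.tsum_prod
  simp only [Function.comp_def, Equiv.prodComm_apply, Prod.swap] at h2 ⊢
  rw [h2]
  simp only [conv, tsum_mul_left]

/-- The derivative is absorbed by the Wiener norm of `d`, so `u` and `e` enter only through L². This
is what allows a difference of solutions to play both roles in the stability estimate. -/
theorem abs_re_pairing_le {Mu Md Me : ℝ} {u d e : ℤ → ℂ} (hu : Decay 3 Mu u) (hd : Decay 3 Md d)
    (he : Decay 3 Me e) :
    |(∑' k, starRingEnd ℂ (e k) * conv u (dx d) k).re| ≤
      wiener d * (sob 0 u + sob 0 e) / 2 := by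
  have h := trilinear_summable_mid
    (summable_norm_sq (hu.mono (by norm_num) le_rfl)) hd.summable_wiener
    (summable_norm_sq (he.mono (by norm_num) le_rfl)) (fun _ => norm_nonneg _)
    (fun k => mul_nonneg (wt_pos k).le (norm_nonneg _)) (fun _ => norm_nonneg _)
  rw [tsum_pairing hu hd he, sob_zero, sob_zero]
  refine (Complex.abs_re_le_norm _).trans
    ((norm_tsum_le_tsum_norm (summable_pairing hu hd he).norm).trans
    (((summable_pairing hu hd he).norm.tsum_le_tsum (fun p => ?_) h.1).trans h.2))
  rw [norm_mul, norm_mul, RCLike.norm_conj, norm_dx, mul_comm]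
  gcongr
  exact abs_le_wt _

/-- Transport by a real velocity is skew-symmetric in `L²` up to a bounded term. -/
theorem abs_re_transport_le {Mu Md : ℝ} {u d : ℤ → ℂ} (hu : Decay 3 Mu u) (hd : Decay 3 Md d)
    (hherm : ∀ k, u (-k) = starRingEnd ℂ (u k)) :
    |(∑' k, starRingEnd ℂ (d k) * conv u (dx d) k).re| ≤ wiener u * sob 0 d := by
  have hF := summable_pairing hu hd hd
  set F : ℤ × ℤ → ℂ := fun p => starRingEnd ℂ (d p.2) * (u (p.2 - p.1) * dx d p.1) with hFdef
  have hG : Summable fun p : ℤ × ℤ => starRingEnd ℂ (F p.swap) :=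
    ((Equiv.prodComm ℤ ℤ).summable_iff.2 hF).star
  have hGs : ∑' p : ℤ × ℤ, starRingEnd ℂ (F p.swap) = starRingEnd ℂ (∑' p, F p) := by
    rw [← (Equiv.prodComm ℤ ℤ).tsum_eq F, Complex.conj_tsum]
    rfl
  have h := trilinear_summable_left hu.summable_wiener
    (summable_norm_sq (hd.mono (by norm_num) le_rfl))
    (summable_norm_sq (hd.mono (by norm_num) le_rfl))
    (fun k => mul_nonneg (wt_pos k).le (norm_nonneg _)) (fun _ => norm_nonneg _)
    (fun _ => norm_nonneg _)
  have hle : ∀ p : ℤ × ℤ, ‖F p + starRingEnd ℂ (F p.swap)‖ ≤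
      wt (p.2 - p.1) * ‖u (p.2 - p.1)‖ * ‖d p.1‖ * ‖d p.2‖ := fun p => by
    obtain ⟨j, k⟩ := p
    -- Integration by parts in frequency: by hermitian symmetry of `u` both terms carry the same
    -- product, with factors j and -k, so the derivative falls on `u` as k - j.
    have : F (j, k) + starRingEnd ℂ (F (k, j)) =
        -(Complex.I * ((k - j : ℤ) : ℂ) * u (k - j) * d j * starRingEnd ℂ (d k)) := by
      simp only [hFdef, dx, map_mul, Complex.conj_conj, Complex.conj_I, map_intCast, ← hherm,
        neg_sub]
      push_cast
      ring
    simp only [Prod.swap_prod_mk]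
    rw [this, norm_neg]
    simp only [norm_mul, Complex.norm_I, one_mul, RCLike.norm_conj, Complex.norm_intCast]
    gcongr
    exact abs_le_wt _
  have key : ‖∑' p, F p + starRingEnd ℂ (∑' p, F p)‖ ≤
      wiener u * (sob 0 d + sob 0 d) / 2 := by
    rw [← hGs, ← hF.tsum_add hG, sob_zero]
    have hs := Summable.of_norm_bounded h.1 hle
    exact (norm_tsum_le_tsum_norm hs.norm).trans ((hs.norm.tsum_le_tsum hle h.1).trans h.2)
  rw [tsum_pairing hu hd hd]
  rw [Complex.add_conj, Complex.norm_real, Real.norm_eq_abs, abs_mul, abs_two] at key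
  have := mul_nonneg (wiener_nonneg u) (sob_nonneg 0 d)
  linarith

/-- Symbol form of the commutator estimate: the mean value theorem gives a factor l (y + l)^(s-1),
and expanding that power separates the case where the weight sits on y from the case where it sits
on l. -/
theorem abs_pow_sub_pow_le_weighted (s : ℕ) {x y l : ℝ} (hx : 0 ≤ x) (hy : 0 ≤ y)
    (hxy : |x - y| ≤ l) :
    |x ^ s - y ^ s| * y ≤ s * 2 ^ s * (l * y ^ s + l ^ s * y) := by
  have hl : 0 ≤ l := (abs_nonneg _).trans hxy
  rcases s with _ | s
  · simp
  have h1 : |x ^ (s + 1) - y ^ (s + 1)| ≤ l * ((s + 1 : ℕ) * (y + l) ^ s) := by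
    refine (abs_pow_sub_pow_le x y (s + 1)).trans ?_
    rw [mul_assoc, abs_of_nonneg hx, abs_of_nonneg hy, Nat.add_sub_cancel]
    gcongr
    exact max_le (by linarith [le_abs_self (x - y)]) (by linarith)
  have h2 : (y + l) ^ s ≤ 2 ^ s * (y ^ s + l ^ s) := by
    refine (add_pow_le hy hl s).trans ?_
    gcongr
    · norm_num
    · omega
  calc _ ≤ l * ((s + 1 : ℕ) * (2 ^ s * (y ^ s + l ^ s))) * y := by
        gcongr
        exact h1.trans (by gcongr)
    _ = (s + 1 : ℕ) * 2 ^ s * (l * y ^ (s + 1) + l ^ (s + 1) * y) := by ring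
    _ ≤ _ := by
      gcongr
      · norm_num
      · omega

theorem abs_wt_sub_le (k j : ℤ) : |wt k - wt j| ≤ wt (k - j) := by
  unfold wt
  have := abs_abs_sub_abs_le (k : ℝ) (j : ℝ)
  push_cast
  rw [add_sub_add_left_eq_sub]
  linarith

theorem abs_mul_abs_wt_pow_sub_le (s : ℕ) (k j : ℤ) :
    |wt k ^ s - wt j ^ s| * |(j : ℝ)| ≤
      s * 2 ^ s * (wt (k - j) * wt j ^ s + wt (k - j) ^ s * wt j) :=
  (mul_le_mul_of_nonneg_left (abs_le_wt j) (abs_nonneg _)).trans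
    (abs_pow_sub_pow_le_weighted s (wt_pos k).le (wt_pos j).le (abs_wt_sub_le k j))

/-- The Sobolev energy estimate for transport by a real velocity. -/
theorem abs_re_energy_le (s : ℕ) {Mu Md : ℝ} {u d : ℤ → ℂ} (hu : Decay (s + 3) Mu u)
    (hd : Decay (2 * s + 3) Md d) (hherm : ∀ k, u (-k) = starRingEnd ℂ (u k)) :
    |(∑' k, ((wt k ^ s) ^ 2 : ℝ) * (starRingEnd ℂ (d k) * conv u (dx d) k)).re| ≤
      (s * 2 ^ s + 1) * (wiener u * sob s d + wiener d * (sob s u + sob s d)) := by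
  set e : ℤ → ℂ := fun k => ((wt k ^ s : ℝ) : ℂ) * d k with he_def
  set e' : ℤ → ℂ := fun k => (((wt k ^ s) ^ 2 : ℝ) : ℂ) * d k with he'_def
  have hnorm : ∀ k, ‖e k‖ = wt k ^ s * ‖d k‖ := fun k => by
    have := wt_pos k
    rw [he_def, norm_mul, Complex.norm_real, Real.norm_of_nonneg (by positivity)]
  -- The order 2s + 3 is used only to justify rearrangements: `e'` carries the weight twice and must
  -- still have decay of order 3. It does not enter the final bound.
  have hd' : Decay (s + 3) Md d := hd.mono (by omega) le_rfl
  have he : Decay 3 Md e := fun k => by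
    rw [hnorm, ← mul_assoc, ← pow_add, add_comm 3]; exact hd' k
  have he' : Decay 3 Md e' := fun k => by
    have := wt_pos k
    rw [he'_def, norm_mul, Complex.norm_real, Real.norm_of_nonneg (by positivity), ← mul_assoc,
      ← pow_mul, ← pow_add, show 3 + s * 2 = 2 * s + 3 by ring]
    exact hd k
  have hu3 : Decay 3 Mu u := hu.mono (by omega) le_rfl
  have hd3 : Decay 3 Md d := hd.mono (by omega) le_rfl
  have hsob : sob 0 e = sob s d := by simp [sob, hnorm]
  have hA := abs_re_transport_le hu3 he hherm
  rw [hsob, tsum_pairing hu3 he he] at hA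
  have hs1 := summable_pairing hu3 he he
  have hs2 := summable_pairing hu3 hd3 he'
  have hlhs : ∑' k, (((wt k ^ s) ^ 2 : ℝ) : ℂ) * (starRingEnd ℂ (d k) * conv u (dx d) k) =
      ∑' k, starRingEnd ℂ (e' k) * conv u (dx d) k := tsum_congr fun k => by
    rw [he'_def]
    simp only [map_mul, Complex.conj_ofReal]
    ring
  have hG := hs2.sub hs1
  -- One weight is moved across the transport operator. What remains is the skew pairing of `e` with
  -- itself plus this commutator, whose kernel contains `wt k ^ s - wt j ^ s`.
  set G : ℤ × ℤ → ℂ := fun p => starRingEnd ℂ (e' p.2) * (u (p.2 - p.1) * dx d p.1) -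
    starRingEnd ℂ (e p.2) * (u (p.2 - p.1) * dx e p.1) with hG_def
  have hsplit : ∑' p : ℤ × ℤ, starRingEnd ℂ (e' p.2) * (u (p.2 - p.1) * dx d p.1) =
      ∑' p : ℤ × ℤ, starRingEnd ℂ (e p.2) * (u (p.2 - p.1) * dx e p.1) + ∑' p, G p := by
    rw [hG_def, hs2.tsum_sub hs1]
    ring
  have h1 := trilinear_summable_left hu3.summable_wiener
    (summable_norm_sq (he.mono (by norm_num) le_rfl))
    (summable_norm_sq (he.mono (by norm_num) le_rfl))
    (fun k => mul_nonneg (wt_pos k).le (norm_nonneg _)) (fun _ => norm_nonneg _)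
    (fun _ => norm_nonneg _)
  have h2 := trilinear_summable_mid (f := fun k => wt k ^ s * ‖u k‖)
    (Decay.summable_sob (hu.mono (by omega) le_rfl)) hd3.summable_wiener
    (summable_norm_sq (he.mono (by norm_num) le_rfl))
    (fun k => mul_nonneg (pow_nonneg (wt_pos k).le _) (norm_nonneg _))
    (fun k => mul_nonneg (wt_pos k).le (norm_nonneg _)) (fun _ => norm_nonneg _)
  have hle : ∀ p : ℤ × ℤ, ‖G p‖ ≤ (s * 2 ^ s : ℝ) *
      (wt (p.2 - p.1) * ‖u (p.2 - p.1)‖ * ‖e p.1‖ * ‖e p.2‖ +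
        wt (p.2 - p.1) ^ s * ‖u (p.2 - p.1)‖ * (wt p.1 * ‖d p.1‖) * ‖e p.2‖) := by
    rintro ⟨j, k⟩
    have hg : G (j, k) = ((wt k ^ s - wt j ^ s : ℝ) : ℂ) *
        (starRingEnd ℂ (e k) * (u (k - j) * dx d j)) := by
      simp only [hG_def, he_def, he'_def, dx, map_mul, Complex.conj_ofReal]
      push_cast
      ring
    rw [hg, norm_mul, norm_mul, norm_mul, RCLike.norm_conj, norm_dx, Complex.norm_real,
      Real.norm_eq_abs]
    calc _ = |wt k ^ s - wt j ^ s| * |(j : ℝ)| * (‖e k‖ * ‖u (k - j)‖ * ‖d j‖) := by ring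
      _ ≤ s * 2 ^ s * (wt (k - j) * wt j ^ s + wt (k - j) ^ s * wt j) *
          (‖e k‖ * ‖u (k - j)‖ * ‖d j‖) := by
        exact mul_le_mul_of_nonneg_right (abs_mul_abs_wt_pow_sub_le s k j) (by positivity)
      _ = _ := by
        simp only [hnorm]
        ring
  have hGle : ‖∑' p, G p‖ ≤ (s * 2 ^ s : ℝ) *
      (wiener u * (sob s d + sob s d) / 2 + wiener d * (sob s u + sob s d) / 2) := by
    refine (norm_tsum_le_tsum_norm hG.norm).trans ((hG.norm.tsum_le_tsum hle
      ((h1.1.add h2.1).mul_left _)).trans ?_)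
    rw [tsum_mul_left, h1.1.tsum_add h2.1]
    gcongr
    · rw [← hsob, sob_zero]; exact h1.2
    · rw [← hsob, sob_zero]; exact h2.2
  rw [hlhs, tsum_pairing hu3 hd3 he', hsplit, Complex.add_re]
  refine (abs_add_le _ _).trans ((add_le_add hA ((Complex.abs_re_le_norm _).trans hGle)).trans ?_)
  have p1 := mul_nonneg (wiener_nonneg u) (sob_nonneg s d)
  have p2 := mul_nonneg (wiener_nonneg d) (add_nonneg (sob_nonneg s u) (sob_nonneg s d))
  have p3 : (0 : ℝ) ≤ s * 2 ^ s := by positivity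
  nlinarith [mul_nonneg p3 p1, mul_nonneg p3 p2]

/-! ### Gronwall inequalities and ordinary differential equations -/

theorem gronwall_le {E E' : ℝ → ℝ} {K T : ℝ} (hc : ContinuousOn E (Icc 0 T))
    (hd : ∀ t ∈ Ioo 0 T, HasDerivAt E (E' t) t) (hle : ∀ t ∈ Ioo 0 T, E' t ≤ K * E t) :
    ∀ t ∈ Icc 0 T, E t ≤ E 0 * Real.exp (K * t) := by
  have hF : ∀ t ∈ Ioo 0 T, HasDerivAt (fun t => E t * Real.exp (-(K * t)))
      (E' t * Real.exp (-(K * t)) + E t * (Real.exp (-(K * t)) * -(K * 1))) t := fun t ht =>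
    (hd t ht).mul (((hasDerivAt_id t).const_mul K).neg.exp)
  have hanti : AntitoneOn (fun t => E t * Real.exp (-(K * t))) (Icc 0 T) := by
    refine antitoneOn_of_deriv_nonpos (convex_Icc 0 T) (hc.mul (by fun_prop)) ?_ ?_
    · rw [interior_Icc]
      exact fun t ht => (hF t ht).differentiableAt.differentiableWithinAt
    · rw [interior_Icc]
      intro t ht
      rw [(hF t ht).deriv]
      have := hle t ht
      have := Real.exp_pos (-(K * t))
      nlinarith
  intro t ht
  have h := hanti (left_mem_Icc.2 (ht.1.trans ht.2)) ht ht.1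
  simp only [mul_zero, neg_zero, Real.exp_zero, mul_one] at h
  calc E t = E t * Real.exp (-(K * t)) * Real.exp (K * t) := by
        rw [mul_assoc, ← Real.exp_add]; simp
    _ ≤ _ := by gcongr

/-- Negative times follow from the forward inequality applied to E(-t), since the hypothesis bounds
the absolute value of the derivative. -/
theorem gronwall_abs_le {E E' : ℝ → ℝ} {K T : ℝ} (hK : 0 ≤ K) (hE : 0 ≤ E 0)
    (hd : ∀ t ∈ Ioo (-T) T, HasDerivAt E (E' t) t) (hle : ∀ t ∈ Ioo (-T) T, |E' t| ≤ K * E t) :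
    ∀ t ∈ Ioo (-T) T, E t ≤ E 0 * Real.exp (K * T) := by
  intro t ht
  have key : ∀ {F F' : ℝ → ℝ} {τ : ℝ}, F 0 = E 0 → 0 ≤ τ → τ < T →
      (∀ t ∈ Ioo (-T) T, HasDerivAt F (F' t) t) → (∀ t ∈ Ioo (-T) T, F' t ≤ K * F t) →
      F τ ≤ E 0 * Real.exp (K * T) := by
    intro F F' τ h0 hτ hτT hF hF'
    have hsub : ∀ r ∈ Icc 0 τ, r ∈ Ioo (-T) T := fun r hr =>
      ⟨by linarith [hr.1], lt_of_le_of_lt hr.2 hτT⟩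
    have := gronwall_le (E := F) (E' := F') (K := K) (T := τ)
      (fun r hr => (hF r (hsub r hr)).continuousAt.continuousWithinAt)
      (fun r hr => hF r (hsub r (Ioo_subset_Icc_self hr)))
      (fun r hr => hF' r (hsub r (Ioo_subset_Icc_self hr))) τ ⟨hτ, le_rfl⟩
    rw [h0] at this
    refine this.trans ?_
    gcongr
  rcases le_total 0 t with h | h
  · exact key rfl h ht.2 hd fun r hr => (le_abs_self _).trans (hle r hr)
  · have hneg : ∀ r ∈ Ioo (-T) T, -r ∈ Ioo (-T) T := fun r hr =>
      ⟨by linarith [hr.2], by linarith [hr.1]⟩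
    have := key (F := fun r => E (-r)) (F' := fun r => -E' (-r)) (τ := -t) (by simp) (by linarith)
      (by linarith [ht.1])
      (fun r hr => by
        simpa [Function.comp_def] using (hd (-r) (hneg r hr)).scomp r (hasDerivAt_neg r))
      (fun r hr => (neg_le_abs _).trans (hle _ (hneg r hr)))
    simpa using this

/-- A compactly supported C¹ field is bounded by some C and globally Lipschitz, so Picard–Lindelöf
applies on all of [-T, T] in a ball of radius C T. -/
theorem exists_solution_of_hasCompactSupport {V : Type*} [NormedAddCommGroup V] [NormedSpace ℝ V]
    [CompleteSpace V] {f : V → V} (hf : ContDiff ℝ 1 f) (hs : HasCompactSupport f) (x₀ : V)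
    {T : ℝ} (hT : 0 ≤ T) :
    ∃ α : ℝ → V, α 0 = x₀ ∧ ∀ t ∈ Ioo (-T) T, HasDerivAt α (f (α t)) t := by
  obtain ⟨C, hC⟩ := hs.exists_bound_of_continuous hf.continuous
  obtain ⟨K, hK⟩ := ContDiff.lipschitzWith_of_hasCompactSupport hs hf one_ne_zero
  have hC0 : 0 ≤ C := (norm_nonneg _).trans (hC 0)
  have hP : IsPicardLindelof (fun _ => f) (tmin := -T) (tmax := T) ⟨0, by simp [hT]⟩ x₀
      ⟨C * T, mul_nonneg hC0 hT⟩ 0 ⟨C, hC0⟩ K :=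
    IsPicardLindelof.of_time_independent (fun x _ => hC x) hK.lipschitzOnWith (by simp; exact le_rfl)
  obtain ⟨α, h0, hα⟩ := hP.exists_eq_forall_mem_Icc_hasDerivWithinAt₀
  exact ⟨α, h0, fun t ht => (hα t (Ioo_subset_Icc_self ht)).hasDerivAt (Icc_mem_nhds ht.1 ht.2)⟩

/-! ### Bounds of the velocity -/

theorem wiener_vel_le {μ c : ℤ → ℂ} {B M : ℝ} (h : IsMult μ B) (hc : Decay 3 M c) :
    wiener (vel μ c) ≤ B * wiener c := by
  have hs := hc.summable_wiener
  have hs' := (Equiv.neg ℤ).summable_iff.2 hs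
  have ht := (Equiv.neg ℤ).tsum_eq fun k => wt k * ‖c k‖
  simp only [Function.comp_def, Equiv.neg_apply, wt_neg] at hs' ht
  have h3 := ((hs.add hs').mul_left (B / 2))
  calc wiener (vel μ c) ≤ ∑' k, B / 2 * (wt k * ‖c k‖ + wt k * ‖c (-k)‖) := by
        refine (hc.vel h).summable_wiener.tsum_le_tsum (fun k => ?_) h3
        calc _ ≤ wt k * (B * ((‖c k‖ + ‖c (-k)‖) / 2)) :=
              mul_le_mul_of_nonneg_left (norm_vel_le h c k) (wt_pos k).le
          _ = _ := by ring
    _ = B * wiener c := by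
      rw [tsum_mul_left, hs.tsum_add hs', ht, wiener]
      ring

theorem sob_vel_le {μ c : ℤ → ℂ} {B M : ℝ} {s : ℕ} (h : IsMult μ B) (hc : Decay (s + 1) M c) :
    sob s (vel μ c) ≤ B ^ 2 * sob s c := by
  have hs := hc.summable_sob
  have hs' := (Equiv.neg ℤ).summable_iff.2 hs
  have ht := (Equiv.neg ℤ).tsum_eq fun k => (wt k ^ s * ‖c k‖) ^ 2
  simp only [Function.comp_def, Equiv.neg_apply, wt_neg] at hs' ht
  have h3 := ((hs.add hs').mul_left (B ^ 2 / 2))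
  calc sob s (vel μ c) ≤
      ∑' k, B ^ 2 / 2 * ((wt k ^ s * ‖c k‖) ^ 2 + (wt k ^ s * ‖c (-k)‖) ^ 2) := by
        refine (hc.vel h).summable_sob.tsum_le_tsum (fun k => ?_) h3
        have hw := wt_pos k
        calc _ ≤ (wt k ^ s * (B * ((‖c k‖ + ‖c (-k)‖) / 2))) ^ 2 := by
              gcongr; exact norm_vel_le h c k
          _ ≤ _ := by
            nlinarith [sq_nonneg (B * (wt k ^ s * ‖c k‖ - wt k ^ s * ‖c (-k)‖))]
    _ = B ^ 2 * sob s c := by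
      rw [tsum_mul_left, hs.tsum_add hs', ht, sob]
      ring

/-- Write the term as `(wt k)⁻¹` times `wt k ^ 2 * ‖c k‖` and use 2xy ≤ x² + y². This makes 2 the
order at which the energy inequality closes on itself. -/
theorem wiener_le_sob {c : ℤ → ℂ} {M : ℝ} (hc : Decay 3 M c) :
    wiener c ≤ (wtSum + sob 2 c) / 2 := by
  have h3 := (summable_inv_wt_sq.add (Decay.summable_sob (s := 2) hc)).div_const 2
  calc wiener c ≤ ∑' k, ((wt k ^ 2)⁻¹ + (wt k ^ 2 * ‖c k‖) ^ 2) / 2 := by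
        refine hc.summable_wiener.tsum_le_tsum (fun k => ?_) h3
        have hw := wt_pos k
        have : wt k * ‖c k‖ = (wt k)⁻¹ * (wt k ^ 2 * ‖c k‖) := by field_simp
        rw [this, ← inv_pow]
        nlinarith [sq_nonneg ((wt k)⁻¹ - wt k ^ 2 * ‖c k‖)]
    _ = _ := by
      rw [tsum_div_const, summable_inv_wt_sq.tsum_add (Decay.summable_sob (s := 2) hc)]
      rfl

/-- The constant of the energy estimate of order `s`. -/
noncomputable def energyConst (B : ℝ) (s : ℕ) : ℝ := (s * 2 ^ s + 1) * (B + B ^ 2 + 1)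

theorem energyConst_nonneg {B : ℝ} (hB : 0 ≤ B) (s : ℕ) : 0 ≤ energyConst B s := by
  unfold energyConst; positivity

/-- The bound is linear in `sob s c`, with the nonlinearity confined to `wiener c`; higher norms
therefore grow at most exponentially while the order-2 norm stays bounded. -/
theorem abs_re_energy_vel_le (s : ℕ) {μ c : ℤ → ℂ} {B M : ℝ} (h : IsMult μ B)
    (hc : Decay (2 * s + 3) M c) :
    |(∑' k, ((wt k ^ s) ^ 2 : ℝ) *
        (starRingEnd ℂ (c k) * conv (vel μ c) (dx c) k)).re| ≤
      energyConst B s * wiener c * sob s c := by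
  have hB := h.nonneg
  have h1 := abs_re_energy_le s ((hc.mono (by omega) le_rfl).vel h) hc (vel_neg h c)
  have h2 := wiener_vel_le h (hc.mono (by omega) le_rfl)
  have h3 := sob_vel_le (s := s) h (hc.mono (by omega) le_rfl)
  have h4 := sob_nonneg s c
  have h5 := wiener_nonneg c
  refine h1.trans ?_
  unfold energyConst
  rw [mul_assoc, mul_assoc]
  refine mul_le_mul_of_nonneg_left ?_ (by positivity)
  calc _ ≤ (B * wiener c) * sob s c + wiener c * (B ^ 2 * sob s c + sob s c) := by gcongr
    _ = _ := by ring

/-! ### Galerkin approximations -/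

theorem decay_of_finite {S : Finset ℤ} {c : ℤ → ℂ} (hc : ∀ k ∉ S, c k = 0) (p : ℕ) :
    Decay p (∑ k ∈ S, wt k ^ p * ‖c k‖) c := fun k => by
  have h : ∀ k ∈ S, 0 ≤ wt k ^ p * ‖c k‖ := fun k _ =>
    mul_nonneg (pow_nonneg (wt_pos k).le _) (norm_nonneg _)
  by_cases hk : k ∈ S
  · exact Finset.single_le_sum (f := fun k => wt k ^ p * ‖c k‖) h hk
  · rw [hc k hk, norm_zero, mul_zero]
    exact Finset.sum_nonneg h

theorem hasDerivAt_sob_of_finite {S : Finset ℤ} {c : ℝ → ℤ → ℂ} (hc : ∀ t, ∀ k ∉ S, c t k = 0)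
    (s : ℕ) {θ t : ℝ} {F : ℤ → ℂ} (hd : ∀ k ∈ S, HasDerivAt (fun t => c t k) (-(θ * F k)) t) :
    HasDerivAt (fun t => sob s (c t))
      (-(2 * θ * (∑' k, ((wt k ^ s) ^ 2 : ℝ) * (starRingEnd ℂ (c t k) * F k)).re)) t := by
  have h1 : ∀ t, sob s (c t) = ∑ k ∈ S, (wt k ^ s) ^ 2 * ‖c t k‖ ^ 2 := fun t => by
    rw [sob, tsum_eq_sum (s := S) fun k hk => by simp [hc t k hk]]
    exact Finset.sum_congr rfl fun k _ => by ring
  have h2 : (∑' k, (((wt k ^ s) ^ 2 : ℝ) : ℂ) * (starRingEnd ℂ (c t k) * F k)) =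
      ∑ k ∈ S, (((wt k ^ s) ^ 2 : ℝ) : ℂ) * (starRingEnd ℂ (c t k) * F k) :=
    tsum_eq_sum fun k hk => by simp [hc t k hk]
  simp only [h1]
  rw [h2]
  have h3 := HasDerivAt.fun_sum (u := S) fun k hk => ((hd k hk).norm_sq).const_mul ((wt k ^ s) ^ 2)
  convert! h3 using 1
  rw [Complex.re_sum, Finset.mul_sum, ← Finset.sum_neg_distrib]
  refine Finset.sum_congr rfl fun k _ => ?_
  rw [Complex.re_ofReal_mul, Complex.inner]
  simp
  ring

/-- Extension by zero of a finite family of coefficients. -/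
noncomputable def extend {S : Finset ℤ} (c : S → ℂ) (k : ℤ) : ℂ := if h : k ∈ S then c ⟨k, h⟩ else 0

theorem extend_of_notMem {S : Finset ℤ} (c : S → ℂ) {k : ℤ} (hk : k ∉ S) : extend c k = 0 :=
  dif_neg hk

theorem extend_coe {S : Finset ℤ} (c : S → ℂ) (k : S) : extend c k = c k := by
  simp [extend]

theorem contDiff_extend {S : Finset ℤ} (k : ℤ) : ContDiff ℝ 1 fun c : S → ℂ => extend c k := by
  unfold extend
  split_ifs with h
  · exact contDiff_apply ℝ ℂ _
  · exact contDiff_const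

theorem sob_extend {S : Finset ℤ} (s : ℕ) (c : S → ℂ) :
    sob s (extend c) = ∑ k ∈ S, (wt k ^ s) ^ 2 * ‖extend c k‖ ^ 2 := by
  rw [sob, tsum_eq_sum (s := S) fun k hk => by simp [extend_of_notMem c hk]]
  exact Finset.sum_congr rfl fun k _ => by ring

theorem contDiff_sob_extend {S : Finset ℤ} (s : ℕ) :
    ContDiff ℝ 1 fun c : S → ℂ => sob s (extend c) := by
  simp only [sob_extend]
  exact ContDiff.sum fun k _ => contDiff_const.mul ((contDiff_extend k).norm_sq ℝ)

/-- The truncated nonlinearity. -/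
noncomputable def transportTrunc (μ : ℤ → ℂ) {S : Finset ℤ} (c : S → ℂ) (k : S) : ℂ :=
  conv (vel μ (extend c)) (dx (extend c)) k

theorem contDiff_transportTrunc (μ : ℤ → ℂ) (S : Finset ℤ) :
    ContDiff ℝ 1 (transportTrunc μ (S := S)) := by
  refine contDiff_pi.2 fun k => ?_
  have : (fun c : S → ℂ => transportTrunc μ c k) = fun c : S → ℂ => ∑ j ∈ S,
      μ (k - j) * ((extend c (k - j) + starRingEnd ℂ (extend c (-(k - j)))) / 2) *
        (Complex.I * j * extend c j) := by
    funext c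
    rw [transportTrunc, conv, tsum_eq_sum (s := S)]
    · rfl
    · intro j hj
      simp [dx, extend_of_notMem c hj]
  rw [this]
  refine ContDiff.sum fun j _ => ?_
  have h1 := contDiff_extend (S := S) (k - j)
  have h2 : ContDiff ℝ 1 fun c : S → ℂ => starRingEnd ℂ (extend c (-(k - j))) :=
    Complex.conjCLE.contDiff.comp (contDiff_extend (S := S) (-(k - j)))
  exact (contDiff_const.mul ((h1.add h2).div_const 2)).mul
    (contDiff_const.mul (contDiff_extend j))

/-- A smooth cut-off equal to `1` on `[0, R]` and to `0` on `[2 R, ∞)`. -/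
noncomputable def cutoff (R x : ℝ) : ℝ := Real.smoothTransition (2 - x / R)

theorem cutoff_of_le {R x : ℝ} (hR : 0 < R) (hx : x ≤ R) : cutoff R x = 1 :=
  Real.smoothTransition.one_of_one_le (by have := (div_le_one hR).2 hx; linarith)

theorem cutoff_of_ge {R x : ℝ} (hR : 0 < R) (hx : 2 * R ≤ x) : cutoff R x = 0 :=
  Real.smoothTransition.zero_of_nonpos (by have := (le_div_iff₀ hR).2 hx; linarith)

theorem contDiff_cutoff (R : ℝ) : ContDiff ℝ 1 (cutoff R) :=
  Real.smoothTransition.contDiff.comp (contDiff_const.sub (contDiff_id.div_const R))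

/-- With finitely many frequencies a bound on `sob 2` confines every coefficient, so the cut-off
turns the quadratic field into one that is globally solvable. -/
theorem hasCompactSupport_cutoff_mul (μ : ℤ → ℂ) (S : Finset ℤ) {R : ℝ} (hR : 0 < R) :
    HasCompactSupport fun c : S → ℂ =>
      -(cutoff R (sob 2 (extend c)) • transportTrunc μ c) := by
  refine HasCompactSupport.intro (isCompact_closedBall (0 : S → ℂ) (1 + 2 * R)) fun c hc => ?_
  have h : 2 * R ≤ sob 2 (extend c) := by
    by_contra hlt
    push Not at hlt
    refine hc (mem_closedBall_zero_iff.2 ((pi_norm_le_iff_of_nonneg (by positivity)).2 fun k => ?_))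
    have h1 : (wt k ^ 2) ^ 2 * ‖extend c k‖ ^ 2 ≤ sob 2 (extend c) := by
      rw [sob_extend]
      exact Finset.single_le_sum (f := fun k => (wt k ^ 2) ^ 2 * ‖extend c k‖ ^ 2)
        (fun k _ => by positivity) k.2
    rw [extend_coe] at h1
    have h2 : 1 ≤ (wt k ^ 2) ^ 2 := by rw [← pow_mul]; exact one_le_wt_pow _ _
    nlinarith [sq_nonneg (‖c k‖ - 1), sq_nonneg ‖c k‖]
  simp [cutoff_of_ge hR h]

/-- Galerkin approximations on a time interval which does not depend on the truncation. -/
theorem exists_galerkin {μ : ℤ → ℂ} {B : ℝ} (hμ : IsMult μ B) {R₀ : ℝ} (hR₀ : 0 ≤ R₀) :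
    ∃ T > 0, ∃ K : ℕ → ℝ, (∀ s, 0 ≤ K s) ∧ ∀ (S : Finset ℤ) (c₀ : ℤ → ℂ), (∀ k ∉ S, c₀ k = 0) →
      sob 2 c₀ ≤ R₀ → ∃ c : ℝ → ℤ → ℂ, c 0 = c₀ ∧ (∀ t, ∀ k ∉ S, c t k = 0) ∧
        (∀ t ∈ Ioo (-T) T, ∀ k ∈ S, HasDerivAt (fun t => c t k)
          (-conv (vel μ (c t)) (dx (c t)) k) t) ∧
        ∀ s, ∀ t ∈ Ioo (-T) T, sob s (c t) ≤ K s * sob s c₀ := by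
  -- The order-2 energy is given one unit of room above its initial bound.
  set R := R₀ + 1 with hRdef
  have hR : 0 < R := by linarith
  have hZ := wtSum_nonneg
  set A : ℕ → ℝ := fun s => energyConst B s * (wtSum + 2 * R) with hA
  have hA0 : ∀ s, 0 ≤ A s := fun s =>
    mul_nonneg (energyConst_nonneg hμ.nonneg s) (by linarith)
  set D := A 2 * (2 * R) with hD
  have hD0 : 0 ≤ D := mul_nonneg (hA0 2) (by linarith)
  -- `D` bounds the speed of the order-2 energy, so during a time `T` it changes by at most D / (D +
  -- 1) < 1. Neither `D` nor `T` depends on `S`.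
  set T := 1 / (D + 1) with hT
  have hT0 : 0 < T := by positivity
  refine ⟨T, hT0, fun s => Real.exp (A s * T), fun s => (Real.exp_pos _).le,
    fun S c₀ hsupp hc₀ => ?_⟩
  obtain ⟨α, hα0, hα⟩ := exists_solution_of_hasCompactSupport
    (f := fun c : S → ℂ => -(cutoff R (sob 2 (extend c)) • transportTrunc μ c))
    ((((contDiff_cutoff R).comp (contDiff_sob_extend 2)).smul (contDiff_transportTrunc μ S)).neg)
    (hasCompactSupport_cutoff_mul μ S hR) (fun k => c₀ k) hT0.le
  set c : ℝ → ℤ → ℂ := fun t => extend (α t) with hc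
  have hzero : ∀ t, ∀ k ∉ S, c t k = 0 := fun t k hk => extend_of_notMem _ hk
  have hc0 : c 0 = c₀ := by
    funext k
    by_cases hk : k ∈ S
    · simp [hc, extend, hk, hα0]
    · rw [hzero 0 k hk, hsupp k hk]
  have hderiv : ∀ t ∈ Ioo (-T) T, ∀ k ∈ S, HasDerivAt (fun t => c t k)
      (-((cutoff R (sob 2 (c t)) : ℝ) * conv (vel μ (c t)) (dx (c t)) k)) t := by
    intro t ht k hk
    have := hasDerivAt_pi.1 (hα t ht) ⟨k, hk⟩
    simpa [hc, extend, hk, transportTrunc] using this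
  have hE := fun (s : ℕ) (t : ℝ) (ht : t ∈ Ioo (-T) T) =>
    hasDerivAt_sob_of_finite hzero s (hderiv t ht)
  have hbound : ∀ s, ∀ t ∈ Ioo (-T) T,
      |(-(2 * cutoff R (sob 2 (c t)) * (∑' k, ((wt k ^ s) ^ 2 : ℝ) *
        (starRingEnd ℂ (c t k) * conv (vel μ (c t)) (dx (c t)) k)).re))| ≤
      cutoff R (sob 2 (c t)) * (energyConst B s * (wtSum + sob 2 (c t)) * sob s (c t)) := by
    intro s t _
    have h1 := abs_re_energy_vel_le s hμ (decay_of_finite (hzero t) (2 * s + 3))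
    have h2 := wiener_le_sob (decay_of_finite (hzero t) 3)
    have h3 : 0 ≤ cutoff R (sob 2 (c t)) := Real.smoothTransition.nonneg _
    have h4 := energyConst_nonneg hμ.nonneg s
    have h5 := sob_nonneg s (c t)
    rw [abs_neg, abs_mul, abs_mul, abs_two, abs_of_nonneg h3]
    calc _ ≤ 2 * cutoff R (sob 2 (c t)) *
          (energyConst B s * ((wtSum + sob 2 (c t)) / 2) * sob s (c t)) := by
          gcongr
          exact h1.trans (by gcongr)
      _ = _ := by ring
  have h0mem : (0 : ℝ) ∈ Ioo (-T) T := ⟨by linarith, hT0⟩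
  -- No continuity argument is needed: the speed bound `D` holds unconditionally, because the
  -- cut-off vanishes once the energy reaches 2R. The outcome is that the cut-off is never active.
  have hE2 : ∀ t ∈ Ioo (-T) T, sob 2 (c t) ≤ R := by
    intro t ht
    have h := Convex.norm_image_sub_le_of_norm_hasDerivWithin_le (s := Ioo (-T) T) (C := D)
      (fun r hr => (hE 2 r hr).hasDerivWithinAt) (fun r hr => ?_) (convex_Ioo _ _) h0mem ht
    · rw [sub_zero, Real.norm_eq_abs, Real.norm_eq_abs, hc0] at h
      have h1 : D * |t| ≤ 1 := by
        have : |t| ≤ T := abs_le.2 ⟨ht.1.le, ht.2.le⟩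
        calc D * |t| ≤ D * T := by gcongr
          _ ≤ 1 := by rw [hT, mul_one_div]; exact (div_le_one (by positivity)).2 (by linarith)
      linarith [le_abs_self (sob 2 (c t) - sob 2 c₀)]
    · refine (hbound 2 r hr).trans ?_
      have h5 := sob_nonneg 2 (c r)
      rcases le_total (2 * R) (sob 2 (c r)) with h | h
      · rw [cutoff_of_ge hR h, zero_mul]
        exact hD0
      · have h4 := energyConst_nonneg hμ.nonneg 2
        calc _ ≤ 1 * (energyConst B 2 * (wtSum + 2 * R) * (2 * R)) := by
              gcongr
              exact Real.smoothTransition.le_one _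
          _ = D := by rw [hD, hA, one_mul]
  refine ⟨c, hc0, hzero, fun t ht k hk => ?_, fun s t ht => ?_⟩
  · simpa [cutoff_of_le hR (hE2 t ht)] using hderiv t ht k hk
  -- Now the cut-off equals 1 and the order-2 energy is at most `R`, so the inequality of order `s`
  -- is linear and lasts for the whole interval.
  · have := gronwall_abs_le (E := fun t => sob s (c t)) (hA0 s) (sob_nonneg s (c 0)) (hE s)
      (fun r hr => ?_) t ht
    · rw [hc0] at this
      linarith
    · refine (hbound s r hr).trans ?_
      rw [cutoff_of_le hR (hE2 r hr), one_mul]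
      have h4 := energyConst_nonneg hμ.nonneg s
      have h5 := sob_nonneg s (c r)
      have := hE2 r hr
      simp only [hA]
      gcongr
      linarith

/-! ### Passage to the limit -/

theorem hasDerivAt_of_norm_sub_le_sq {f : ℝ → ℂ} {f' : ℂ} {t C : ℝ} {I : Set ℝ} (hI : I ∈ 𝓝 t)
    (h : ∀ r ∈ I, ‖f r - f t - (r - t) • f'‖ ≤ C * |r - t| ^ 2) : HasDerivAt f f' t := by
  rw [hasDerivAt_iff_isLittleO]
  have h1 : (fun r => f r - f t - (r - t) • f') =O[𝓝 t] fun r => (r - t) ^ 2 :=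
    Asymptotics.IsBigO.of_bound C (by
      filter_upwards [hI] with r hr
      simpa using h r hr)
  refine h1.trans_isLittleO ?_
  have h2 : (fun r : ℝ => r - t) =o[𝓝 t] fun _ => (1 : ℝ) := by
    rw [Asymptotics.isLittleO_one_iff]
    have : Tendsto (fun r : ℝ => r - t) (𝓝 t) (𝓝 (t - t)) := tendsto_id.sub_const t
    simpa using this
  simpa [pow_two] using (Asymptotics.isBigO_refl (fun r : ℝ => r - t) (𝓝 t)).mul_isLittleO h2

/-- A Lipschitz derivative gives a quadratic Taylor remainder. Such an inequality passes to
pointwise limits, and `hasDerivAt_of_norm_sub_le_sq` recovers the derivative from it afterwards. -/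
theorem norm_sub_sub_le_sq {f f' : ℝ → ℂ} {L : ℝ} {a b t r : ℝ} (hL : 0 ≤ L) (ht : t ∈ Ioo a b)
    (hr : r ∈ Ioo a b) (hf : ∀ x ∈ Ioo a b, HasDerivAt f (f' x) x)
    (hf' : ∀ x ∈ Ioo a b, ‖f' x - f' t‖ ≤ L * |x - t|) :
    ‖f r - f t - (r - t) • f' t‖ ≤ L * |r - t| ^ 2 := by
  have hsub : uIcc t r ⊆ Ioo a b := by
    intro x hx
    exact (ordConnected_Ioo.uIcc_subset ht hr) hx
  have h := Convex.norm_image_sub_le_of_norm_hasDerivWithin_le (s := uIcc t r)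
    (f := fun x => f x - x • f' t) (f' := fun x => f' x - f' t) (C := L * |r - t|)
    (fun x hx => by
      have := (hf x (hsub hx)).fun_sub ((hasDerivAt_id x).smul_const (f' t))
      simpa using this.hasDerivWithinAt)
    (fun x hx => (hf' x (hsub hx)).trans (by
      gcongr 1
      exact abs_sub_left_of_mem_uIcc hx)) (convex_uIcc t r)
    left_mem_uIcc right_mem_uIcc
  rw [Real.norm_eq_abs] at h
  calc _ = ‖f r - r • f' t - (f t - t • f' t)‖ := by
        congr 1
        simp only [Complex.real_smul]
        push_cast
        ring
    _ ≤ _ := h.trans_eq (by ring)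

theorem conv_sub_conv {M M' M₂ M₂' : ℝ} {u d u' d' : ℤ → ℂ} (hu : Decay 0 M u) (hd : Decay 2 M' d)
    (hu' : Decay 0 M₂ u') (hd' : Decay 2 M₂' d') (k : ℤ) :
    conv u d k - conv u' d' k =
      conv (fun k => u k - u' k) d k + conv u' (fun k => d k - d' k) k := by
  unfold conv
  rw [← (summable_conv hu hd k).tsum_sub (summable_conv hu' hd' k),
    ← (summable_conv (hu.sub hu') hd k).tsum_add (summable_conv hu' (hd.sub hd') k)]
  exact tsum_congr fun j => by ring

/-- The right-hand side of the equation for the Fourier coefficients. -/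
noncomputable def rhs (μ c : ℤ → ℂ) (k : ℤ) : ℂ := -conv (vel μ c) (dx c) k

/-- Three orders are lost, one for the derivative and two for summation, but only by one of the two
copies of `c`. -/
theorem Decay.rhs {p : ℕ} {M M' B : ℝ} {c μ : ℤ → ℂ} (h : IsMult μ B) (hc : Decay p M c)
    (hc' : Decay (p + 3) M' c) : Decay p (B * M * M' * wtSum) (rhs μ c) :=
  ((hc.vel h).conv (p := p) (Decay.dx (p := p + 2) hc')).neg

theorem norm_rhs_sub_le {M M' D B : ℝ} {c d μ : ℤ → ℂ} (h : IsMult μ B) (hc : Decay 3 M c)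
    (hd : Decay 3 M' d) (hcd : Decay 3 D (fun k => c k - d k)) (k : ℤ) :
    ‖rhs μ c k - rhs μ d k‖ ≤ B * wtSum * (M + M') * D := by
  have h1 := ((hcd.mono (Nat.zero_le 3) le_rfl).vel h).conv (p := 0) (Decay.dx (p := 2) hc) k
  have h2 := ((hd.mono (Nat.zero_le 3) le_rfl).vel h).conv (p := 0) (Decay.dx (p := 2) hcd) k
  have h3 := conv_sub_conv (((hc.mono (Nat.zero_le 3) le_rfl)).vel h) (Decay.dx (p := 2) hc)
    (((hd.mono (Nat.zero_le 3) le_rfl)).vel h) (Decay.dx (p := 2) hd) k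
  simp only [← vel_sub, ← dx_sub] at h3
  rw [pow_zero, one_mul] at h1 h2
  calc _ = ‖conv (vel μ c) (dx c) k - conv (vel μ d) (dx d) k‖ := by
        rw [← norm_neg]; congr 1; simp only [rhs]; ring
    _ ≤ _ := by
        rw [h3]
        exact (norm_add_le _ _).trans ((add_le_add h1 h2).trans_eq (by ring))

theorem tendsto_rhs {ι : Type*} {l : Filter ι} {μ : ℤ → ℂ} {B M : ℝ} (h : IsMult μ B)
    {c : ι → ℤ → ℂ} {d : ℤ → ℂ} (hc : ∀ i, Decay 3 M (c i))
    (hcd : ∀ k, Tendsto (fun i => c i k) l (𝓝 (d k))) (k : ℤ) :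
    Tendsto (fun i => rhs μ (c i) k) l (𝓝 (rhs μ d k)) := by
  refine (tendsto_tsum_of_dominated_convergence (bound := fun j => B * M * M * (wt j ^ 2)⁻¹)
    (summable_inv_wt_sq.mul_left _) (fun j => ?_) (Eventually.of_forall fun i j => ?_)).neg
  · have h1 : Tendsto (fun i => vel μ (c i) (k - j)) l (𝓝 (vel μ d (k - j))) :=
      (((hcd _).add ((Complex.continuous_conj.tendsto _).comp (hcd _))).div_const 2).const_mul _
    exact h1.mul ((hcd j).const_mul _)
  · simpa using norm_conv_term_le (p := 0) (((hc i).mono (Nat.zero_le 3) le_rfl).vel h)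
      (Decay.dx (p := 2) (hc i)) k j

/-- Truncation of a sequence to a finite set of frequencies. -/
noncomputable def trunc (S : Finset ℤ) (c : ℤ → ℂ) (k : ℤ) : ℂ := if k ∈ S then c k else 0

theorem norm_trunc_le (S : Finset ℤ) (c : ℤ → ℂ) (k : ℤ) : ‖trunc S c k‖ ≤ ‖c k‖ := by
  unfold trunc; split_ifs <;> simp

theorem Decay.trunc {p : ℕ} {M : ℝ} {c : ℤ → ℂ} (hc : Decay p M c) (S : Finset ℤ) :
    Decay p M (trunc S c) := fun k =>
  (mul_le_mul_of_nonneg_left (norm_trunc_le S c k) (pow_nonneg (wt_pos k).le _)).trans (hc k)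

theorem decay_of_sob_le {s : ℕ} {M E : ℝ} {c : ℤ → ℂ} (hc : Decay (s + 1) M c) (hE : sob s c ≤ E) :
    Decay s (√E) c := fun k =>
  Real.le_sqrt_of_sq_le ((hc.summable_sob.le_tsum k fun _ _ => sq_nonneg _).trans hE)

theorem exists_coefficient_solution {μ : ℤ → ℂ} {B : ℝ} (hμ : IsMult μ B) (R₀ : ℝ) :
    ∃ T > 0, ∃ Φ : ℕ → ℝ → ℝ, ∀ c₀ : ℤ → ℂ, Decay 3 R₀ c₀ → (∀ p, ∃ M, Decay p M c₀) →
      ∃ c : ℝ → ℤ → ℂ, c 0 = c₀ ∧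
        (∀ t ∈ Ioo (-T) T, ∀ k, HasDerivAt (fun t => c t k) (rhs μ (c t) k) t) ∧
        ∀ s M, Decay (s + 1) M c₀ → ∀ t ∈ Ioo (-T) T, Decay s (Φ s M) (c t) := by
  have hZ := wtSum_nonneg
  -- Decay of order 3 with constant `R₀` bounds `sob 2` by this value: squaring leaves `(wt k ^
  -- 2)⁻¹` to sum.
  obtain ⟨T, hT, K, hK, hgal⟩ := exists_galerkin hμ (R₀ := R₀ ^ 2 * wtSum) (by positivity)
  refine ⟨T, hT, fun s M => √(K s * (M ^ 2 * wtSum)), fun c₀ hc₀ hdec => ?_⟩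
  set S : ℕ → Finset ℤ := fun N => Finset.Icc (-(N : ℤ)) N with hS
  choose c hc0 hsupp hder hsob using fun N => hgal (S N) (trunc (S N) c₀)
    (fun k hk => by simp [trunc, hk]) ((hc₀.trunc (S N)).sob_le (s := 2))
  have hdecN : ∀ s M, Decay (s + 1) M c₀ → ∀ N, ∀ t ∈ Ioo (-T) T,
      Decay s (√(K s * (M ^ 2 * wtSum))) (c N t) := fun s M hM N t ht =>
    decay_of_sob_le (decay_of_finite (hsupp N t) (s + 1)) ((hsob N s t ht).trans
      (mul_le_mul_of_nonneg_left (hM.trunc (S N)).sob_le (hK s)))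
  have hunif : ∀ p, ∃ M, 0 ≤ M ∧ ∀ N, ∀ t ∈ Ioo (-T) T, Decay p M (c N t) := fun p => by
    obtain ⟨M, hM⟩ := hdec (p + 1)
    exact ⟨_, Real.sqrt_nonneg _, hdecN p M hM⟩
  obtain ⟨M₃, hM₃0, hM₃⟩ := hunif 3
  obtain ⟨M₆, hM₆0, hM₆⟩ := hunif 6
  have hB := hμ.nonneg
  -- Lipschitz dependence on time, uniformly in the truncation, in the decay norm of order 3. Decay
  -- of order 6 is needed because the right-hand side loses three orders.
  have hLip : ∀ N, ∀ t ∈ Ioo (-T) T, ∀ r ∈ Ioo (-T) T,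
      Decay 3 (B * M₃ * M₆ * wtSum * |r - t|) (fun k => c N r k - c N t k) := by
    intro N t ht r hr k
    have hw := wt_pos k
    have h := Convex.norm_image_sub_le_of_norm_hasDerivWithin_le (s := Ioo (-T) T)
      (f := fun t => ((wt k ^ 3 : ℝ) : ℂ) * c N t k)
      (f' := fun t => ((wt k ^ 3 : ℝ) : ℂ) * (if k ∈ S N then rhs μ (c N t) k else 0))
      (C := B * M₃ * M₆ * wtSum) (fun x hx => ?_) (fun x hx => ?_) (convex_Ioo _ _) ht hr
    · rw [← mul_sub, norm_mul, Complex.norm_real, Real.norm_of_nonneg (by positivity)] at h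
      exact h
    · refine (HasDerivAt.const_mul _ ?_).hasDerivWithinAt
      split_ifs with hk
      · exact hder N x hx k hk
      · simp only [hsupp N _ k hk]
        exact hasDerivAt_const _ _
    · rw [norm_mul, Complex.norm_real, Real.norm_of_nonneg (by positivity)]
      split_ifs with hk
      · exact (hM₃ N x hx).rhs hμ (hM₆ N x hx) k
      · rw [norm_zero, mul_zero]
        positivity
  -- Bounded complex numbers converge along an ultrafilter, so all coefficients at all times get a
  -- limit at once, with no diagonal extraction or Arzelà–Ascoli argument.
  set U : Ultrafilter ℕ := hyperfilter ℕ
  have hUtop : (U : Filter ℕ) ≤ atTop := Nat.hyperfilter_le_atTop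
  have hlim : ∀ t k, ∃ z, t ∈ Ioo (-T) T → Tendsto (fun N => c N t k) U (𝓝 z) := by
    intro t k
    by_cases ht : t ∈ Ioo (-T) T
    · obtain ⟨z, -, hz⟩ := (isCompact_closedBall (0 : ℂ) M₃).ultrafilter_le_nhds
        (U.map fun N => c N t k) (by
          rw [le_principal_iff]
          refine mem_map.2 (Eventually.of_forall fun N => ?_)
          simpa using ((hM₃ N t ht).mono (Nat.zero_le 3) le_rfl) k)
      exact ⟨z, fun _ => hz⟩
    · exact ⟨0, fun h => absurd h ht⟩
  choose d hd using hlim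
  have hmem : ∀ k : ℤ, ∀ᶠ N in (U : Filter ℕ), k ∈ S N := fun k => by
    refine hUtop (eventually_atTop.2 ⟨k.natAbs, fun N hN => ?_⟩)
    simp only [hS, Finset.mem_Icc]
    omega
  have h0 : (0 : ℝ) ∈ Ioo (-T) T := ⟨by linarith, hT⟩
  refine ⟨d, ?_, fun t ht k => ?_, fun s M hM t ht k => ?_⟩
  · funext k
    refine tendsto_nhds_unique (hd 0 k h0) (tendsto_const_nhds.congr' ?_)
    filter_upwards [hmem k] with N hN
    simp [hc0, trunc, hN]
  -- The Taylor estimate holds for the approximations, as soon as `k ∈ S N`, with a constant free of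
  -- `N`; the limit inherits it.
  · set L := B * wtSum * (M₃ + M₃) * (B * M₃ * M₆ * wtSum)
    refine hasDerivAt_of_norm_sub_le_sq (C := L) (Ioo_mem_nhds ht.1 ht.2) fun r hr => ?_
    have ht3 : Tendsto (fun N => rhs μ (c N t) k) U (𝓝 (rhs μ (d t) k)) :=
      tendsto_rhs hμ (fun N => hM₃ N t ht) (fun k => hd t k ht) k
    refine le_of_tendsto ((((hd r k hr).sub (hd t k ht)).sub (ht3.const_smul (r - t))).norm) ?_
    filter_upwards [hmem k] with N hN
    refine norm_sub_sub_le_sq (f := fun t => c N t k) (f' := fun t => rhs μ (c N t) k)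
      (by positivity) ht hr (fun x hx => hder N x hx k hN) fun x hx => ?_
    refine (norm_rhs_sub_le hμ (hM₃ N x hx) (hM₃ N t ht) (hLip N t ht x hx) k).trans_eq ?_
    ring
  · exact le_of_tendsto (((hd t k ht).norm).const_mul _)
      (Eventually.of_forall fun N => hdecN s M hM N t ht k)

/-! ### The Fourier symbol of `H_a` -/

theorem abs_K_of_pos {a y : ℝ} (hy : 0 < y) :
    |K a y| = 1 / (Real.pi * y) * (a ^ 2 / (y ^ 2 + a ^ 2)) := by
  have := Real.pi_pos
  exact abs_of_nonneg (by unfold K; positivity)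

theorem abs_K_le {a y : ℝ} (ha : 0 < a) (hy : 0 < y) : |K a y| ≤ 1 / (Real.pi * y) := by
  have := Real.pi_pos
  rw [abs_K_of_pos hy]
  refine mul_le_of_le_one_right (by positivity) ((div_le_one (by positivity)).2 ?_)
  nlinarith [sq_nonneg y]

/-- A factor vanishing linearly at 0 cancels the 1/y singularity and leaves the integrable bump;
this is how the principal value becomes an absolutely convergent integral. -/
theorem abs_mul_K_le {a y z C : ℝ} (hy : 0 < y) (hz : |z| ≤ C * y) :
    |z * K a y| ≤ C / Real.pi * (a ^ 2 / (y ^ 2 + a ^ 2)) := by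
  have hp := Real.pi_pos
  rw [abs_mul, abs_K_of_pos hy]
  calc _ ≤ C * y * (1 / (Real.pi * y) * (a ^ 2 / (y ^ 2 + a ^ 2))) := by gcongr
    _ = _ := by field_simp

theorem integrableOn_mul_K {a C : ℝ} (ha : 0 < a) {h : ℝ → ℝ} (hm : Measurable h)
    (hle : ∀ y, 0 < y → |h y| ≤ C * y) : IntegrableOn (fun y => h y * K a y) (Ioi 0) := by
  refine Integrable.mono' (((integrable_bump ha).const_mul (C / Real.pi)).integrableOn)
    (hm.mul (measurable_K a)).aestronglyMeasurable ?_
  exact (ae_restrict_iff' measurableSet_Ioi).2 (Eventually.of_forall fun y hy =>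
    abs_mul_K_le hy (hle y hy))

theorem abs_sin_mul_le (l : ℝ) {y : ℝ} (hy : 0 < y) : |Real.sin (l * y)| ≤ |l| * y := by
  have := Real.abs_sin_le_abs (x := l * y)
  rwa [abs_mul, abs_of_pos hy] at this

theorem integrableOn_sin_mul_K {a : ℝ} (ha : 0 < a) (l : ℝ) :
    IntegrableOn (fun y => Real.sin (l * y) * K a y) (Ioi 0) :=
  integrableOn_mul_K ha (by fun_prop) fun _ hy => abs_sin_mul_le l hy

/-- `H_a` acts on `exp (i l x)` as multiplication by `-i * symb a l`. -/
noncomputable def symb (a l : ℝ) : ℝ := 2 * ∫ y in Ioi 0, Real.sin (l * y) * K a y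

theorem symb_neg (a l : ℝ) : symb a (-l) = -symb a l := by
  simp [symb, integral_neg]

theorem hasDerivAt_K {a y : ℝ} (ha : 0 < a) (hy : 0 < y) :
    HasDerivAt (K a) (-(a ^ 2 / Real.pi * ((3 * y ^ 2 + a ^ 2) / (y * (y ^ 2 + a ^ 2)) ^ 2))) y := by
  have hp := Real.pi_pos
  have hK : K a = fun y => a ^ 2 / Real.pi * (y * (y ^ 2 + a ^ 2))⁻¹ := by
    funext y
    unfold K
    rw [mul_inv, div_mul_div_comm, one_mul, div_mul_eq_div_div_swap]
    simp only [div_eq_mul_inv, mul_inv]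
    ring
  rw [hK]
  have h1 : HasDerivAt (fun y : ℝ => y * (y ^ 2 + a ^ 2)) (3 * y ^ 2 + a ^ 2) y := by
    have := (hasDerivAt_id y).mul (((hasDerivAt_id y).pow 2).add_const (a ^ 2))
    convert! this using 1
    simp
    ring
  have := (h1.inv (by positivity)).const_mul (a ^ 2 / Real.pi)
  convert! this using 1
  ring

theorem tendsto_K_atTop {a : ℝ} (ha : 0 < a) : Tendsto (K a) atTop (𝓝 0) := by
  have hp := Real.pi_pos
  have h : Tendsto (fun y : ℝ => 1 / (Real.pi * y)) atTop (𝓝 0) := by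
    simp only [one_div]
    exact (tendsto_id.const_mul_atTop hp).inv_tendsto_atTop
  refine squeeze_zero_norm' ?_ h
  filter_upwards [eventually_gt_atTop 0] with y hy
  exact abs_K_le ha hy

/-- Split at y = 1/l. Below, |sin(ly)| ≤ ly and K ≤ 1/(πy) bound the integrand by l, contributing at
most 1. Above, integrate by parts: K decreases to 0, so the total variation equals K(1/l) ≤ l/π, and
the contribution is at most 2. -/
theorem abs_integral_sin_mul_K_le {a l : ℝ} (ha : 0 < a) (hl : 0 < l) :
    |∫ y in Ioi 0, Real.sin (l * y) * K a y| ≤ 3 := by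
  have hp := Real.pi_gt_three
  have hi := integrableOn_sin_mul_K ha l
  set b := 1 / l with hb
  have hb0 : 0 < b := by positivity
  have hKb : 0 ≤ K a b := by unfold K; positivity
  have hKb' : K a b ≤ 1 / (Real.pi * b) := (le_abs_self _).trans (abs_K_le ha hb0)
  set K' : ℝ → ℝ := fun y => -(a ^ 2 / Real.pi * ((3 * y ^ 2 + a ^ 2) / (y * (y ^ 2 + a ^ 2)) ^ 2))
    with hK'
  have hd : ∀ y ∈ Ici b, HasDerivAt (K a) (K' y) y := fun y hy =>
    hasDerivAt_K ha (hb0.trans_le hy)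
  have hneg : ∀ y ∈ Ioi b, K' y ≤ 0 := fun y _ => neg_nonpos.2 (by positivity)
  have hint := integrableOn_Ioi_deriv_of_nonpos' hd hneg (tendsto_K_atTop ha)
  have hval := integral_Ioi_of_hasDerivAt_of_nonpos' hd hneg (tendsto_K_atTop ha)
  have hcos : IntegrableOn (fun y => Real.cos (l * y) * K' y) (Ioi b) := by
    refine hint.norm.mono' ((by fun_prop : Continuous fun y => Real.cos (l * y)).measurable
      |>.aestronglyMeasurable.mul hint.1) (Eventually.of_forall fun y => ?_)
    rw [norm_mul]
    exact mul_le_of_le_one_left (norm_nonneg _) (Real.abs_cos_le_one _)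
  have hsplit : ∫ y in Ioi 0, Real.sin (l * y) * K a y =
      (∫ y in Ioc 0 b, Real.sin (l * y) * K a y) + ∫ y in Ioi b, Real.sin (l * y) * K a y := by
    rw [← setIntegral_union Ioc_disjoint_Ioi_same measurableSet_Ioi
      (hi.mono_set Ioc_subset_Ioi_self) (hi.mono_set (Ioi_subset_Ioi hb0.le)),
      Ioc_union_Ioi_eq_Ioi hb0.le]
  have hfirst : |∫ y in Ioc 0 b, Real.sin (l * y) * K a y| ≤ 1 := by
    have h := norm_setIntegral_le_of_norm_le_const (μ := volume) (s := Ioc 0 b)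
      (f := fun y => Real.sin (l * y) * K a y) (C := l) (by simp) (fun y hy => ?_)
    · rw [Real.norm_eq_abs] at h
      refine h.trans_eq ?_
      rw [Real.volume_real_Ioc_of_le hb0.le, sub_zero, hb, mul_one_div_cancel hl.ne']
    · rw [Real.norm_eq_abs, abs_mul]
      calc _ ≤ |l| * y * (1 / (Real.pi * y)) := by
            exact mul_le_mul (abs_sin_mul_le l hy.1) (abs_K_le ha hy.1) (abs_nonneg _)
              (mul_nonneg (abs_nonneg _) hy.1.le)
        _ = l / Real.pi := by have := hy.1; rw [abs_of_pos hl]; field_simp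
        _ ≤ l := div_le_self hl.le (by linarith)
  have hF : ∀ y ∈ Ici b, HasDerivAt (fun y => Real.cos (l * y) * K a y)
      (-l * (Real.sin (l * y) * K a y) + Real.cos (l * y) * K' y) y := fun y hy => by
    have h1 : HasDerivAt (fun y => Real.cos (l * y)) (-Real.sin (l * y) * (l * 1)) y :=
      ((hasDerivAt_id y).const_mul l).cos
    convert! h1.mul (hd y hy) using 1
    ring
  have hFlim : Tendsto (fun y => Real.cos (l * y) * K a y) atTop (𝓝 0) := by
    have h0 := (tendsto_K_atTop ha).norm
    rw [norm_zero] at h0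
    refine squeeze_zero_norm (fun y => ?_) h0
    rw [norm_mul]
    exact mul_le_of_le_one_left (norm_nonneg _) (Real.abs_cos_le_one _)
  have hi2 := hi.mono_set (Ioi_subset_Ioi hb0.le)
  have hFint := integral_Ioi_of_hasDerivAt_of_tendsto' hF ((hi2.const_mul (-l)).add hcos) hFlim
  rw [integral_add (hi2.const_mul (-l)) hcos, integral_const_mul] at hFint
  have hcosle : |∫ y in Ioi b, Real.cos (l * y) * K' y| ≤ K a b := by
    calc _ ≤ ∫ y in Ioi b, -K' y := by
          rw [← Real.norm_eq_abs]
          refine norm_integral_le_of_norm_le (g := fun y => -K' y) hint.neg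
            ((ae_restrict_iff' measurableSet_Ioi).2 (Eventually.of_forall fun y hy => ?_))
          rw [norm_mul, Real.norm_eq_abs, Real.norm_eq_abs, abs_of_nonpos (hneg y hy)]
          exact mul_le_of_le_one_left (neg_nonneg.2 (hneg y hy)) (Real.abs_cos_le_one _)
      _ = K a b := by rw [integral_neg, hval]; ring
  have hsecond : |∫ y in Ioi b, Real.sin (l * y) * K a y| ≤ 2 := by
    have h1 : |Real.cos (l * b) * K a b| ≤ K a b := by
      rw [abs_mul, abs_of_nonneg hKb]
      exact mul_le_of_le_one_left hKb (Real.abs_cos_le_one _)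
    have h2 : l * |∫ y in Ioi b, Real.sin (l * y) * K a y| ≤ 2 * K a b := by
      rw [← abs_of_pos hl, ← abs_mul, abs_of_pos hl]
      have : l * ∫ y in Ioi b, Real.sin (l * y) * K a y =
        (∫ y in Ioi b, Real.cos (l * y) * K' y) + Real.cos (l * b) * K a b := by linarith
      rw [this]
      exact (abs_add_le _ _).trans (by linarith)
    have h3 : 1 / (Real.pi * b) ≤ l := by
      rw [hb, mul_one_div, one_div_div]
      exact div_le_self hl.le (by linarith)
    exact le_of_mul_le_mul_left (by linarith) hl
  rw [hsplit]
  exact (abs_add_le _ _).trans (by linarith)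

theorem abs_symb_le {a : ℝ} (ha : 0 < a) (l : ℝ) : |symb a l| ≤ 6 := by
  have key : ∀ l, 0 < l → |symb a l| ≤ 6 := fun l hl => by
    have := abs_integral_sin_mul_K_le ha hl
    rw [symb, abs_mul, abs_two]
    linarith
  rcases lt_trichotomy l 0 with h | rfl | h
  · have := key (-l) (by linarith)
    rwa [symb_neg, abs_neg] at this
  · simp [symb]
  · exact key l h

/-- The Fourier multiplier of the velocity `g H_a`. -/
noncomputable def mult (a g : ℝ) (l : ℤ) : ℂ := -(Complex.I * ((g * symb a l : ℝ) : ℂ))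

theorem isMult_mult {a g : ℝ} (ha : 0 < a) (hg : 0 < g) : IsMult (mult a g) (6 * g) where
  bound l := by
    rw [mult, norm_neg, norm_mul, Complex.norm_I, one_mul, Complex.norm_real, Real.norm_eq_abs,
      abs_mul, abs_of_pos hg, mul_comm]
    gcongr
    exact abs_symb_le ha l
  herm l := by
    simp [mult, symb_neg]

/-! ### Exponentials and the action of `H_a` on Fourier series -/

/-- The exponential `exp (i k x)`. -/
noncomputable def ex (k : ℤ) (x : ℝ) : ℂ := Complex.exp (Complex.I * k * x)

theorem ex_add (k : ℤ) (x y : ℝ) : ex k (x + y) = ex k x * ex k y := by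
  simp only [ex, ← Complex.exp_add]
  congr 1
  push_cast
  ring

theorem ex_add_left (k j : ℤ) (x : ℝ) : ex (k + j) x = ex k x * ex j x := by
  simp only [ex, ← Complex.exp_add]
  congr 1
  push_cast
  ring

theorem norm_ex (k : ℤ) (x : ℝ) : ‖ex k x‖ = 1 := by
  rw [ex, show Complex.I * k * x = ((k * x : ℝ) : ℂ) * Complex.I by push_cast; ring]
  exact Complex.norm_exp_ofReal_mul_I _

theorem conj_ex (k : ℤ) (x : ℝ) : starRingEnd ℂ (ex k x) = ex (-k) x := by
  simp [ex, ← Complex.exp_conj]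

theorem hasDerivAt_ex (k : ℤ) (x : ℝ) : HasDerivAt (ex k) (Complex.I * k * ex k x) x := by
  have h : HasDerivAt (fun x : ℝ => Complex.I * k * (x : ℂ)) (Complex.I * k) x := by
    simpa using (Complex.ofRealCLM.hasDerivAt (x := x)).const_mul (Complex.I * k)
  convert! h.cexp using 1
  exact mul_comm _ _

theorem continuous_ex (k : ℤ) : Continuous (ex k) := by
  unfold ex; fun_prop

theorem ex_neg_sub_ex (l : ℤ) (y : ℝ) :
    ex l (-y) - ex l y = -(Complex.I * ((2 * Real.sin (l * y) : ℝ) : ℂ)) := by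
  have h1 : ex l y = Complex.cos (l * y) + Complex.sin (l * y) * Complex.I := by
    rw [ex, show Complex.I * l * y = (l * y : ℂ) * Complex.I by ring, Complex.exp_mul_I]
  have h2 : ex l (-y) = Complex.cos (l * y) - Complex.sin (l * y) * Complex.I := by
    rw [ex, show Complex.I * l * ((-y : ℝ) : ℂ) = (-(l * y) : ℂ) * Complex.I by push_cast; ring,
      Complex.exp_mul_I, Complex.cos_neg, Complex.sin_neg]
    ring
  rw [h1, h2]
  push_cast
  ring

/-- Folding y to -y by oddness of the kernel produces a difference that is O(y); the truncated
integrals then converge by exhaustion of the half-line, tested along ε = 1/(n+1). -/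
theorem H_eq_integral {a : ℝ} (ha : 0 < a) {f : ℝ → ℝ} (hf : SmoothPeriodic f) (x : ℝ) :
    IntegrableOn (fun y => (f (x - y) - f (x + y)) * K a y) (Ioi 0) ∧
    H a f x = ∫ y in Ioi 0, (f (x - y) - f (x + y)) * K a y := by
  obtain ⟨L, hL0, hL⟩ := hf.exists_lipschitz
  have hc := hf.smooth.continuous
  have hi : IntegrableOn (fun y => (f (x - y) - f (x + y)) * K a y) (Ioi 0) := by
    refine integrableOn_mul_K (C := 2 * L) ha
      (by fun_prop : Continuous fun y => f (x - y) - f (x + y)).measurable fun y hy => ?_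
    refine (hL _ _).trans_eq ?_
    rw [show x - y - (x + y) = -(2 * y) by ring, abs_neg, abs_of_pos (by linarith)]
    ring
  refine ⟨hi, ?_⟩
  set ε : ℕ → ℝ := fun n => 1 / ((n : ℝ) + 1) with hε
  have hε0 : ∀ n, 0 < ε n := fun n => by positivity
  have hlim : Tendsto ε atTop (𝓝[>] 0) :=
    tendsto_nhdsWithin_iff.2 ⟨tendsto_one_div_add_atTop_nhds_zero_nat, Eventually.of_forall hε0⟩
  have hU : (⋃ n, Ioi (ε n)) = Ioi 0 := by
    ext y
    simp only [mem_iUnion, mem_Ioi]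
    exact ⟨fun ⟨n, hn⟩ => (hε0 n).trans hn, fun hy => exists_nat_one_div_lt hy⟩
  have h1 := tendsto_setIntegral_of_monotone (μ := volume) (s := fun n => Ioi (ε n))
    (f := fun y => (f (x - y) - f (x + y)) * K a y) (fun n => measurableSet_Ioi)
    (fun m n hmn => Ioi_subset_Ioi (one_div_le_one_div_of_le (by positivity) (by
      have : (m : ℝ) ≤ n := by exact_mod_cast hmn
      linarith))) (by rwa [hU])
  rw [hU] at h1
  refine tendsto_nhds_unique (((tendsto_truncH ha hf x).comp hlim)) (h1.congr fun n => ?_)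
  exact (truncH_eq ha hf x (hε0 n)).symm

/-- The function with Fourier coefficients `c`. -/
noncomputable def series (c : ℤ → ℂ) (x : ℝ) : ℂ := ∑' k, c k * ex k x

theorem Decay.summable_series {M : ℝ} {c : ℤ → ℂ} (hc : Decay 2 M c) (x : ℝ) :
    Summable fun k => c k * ex k x :=
  Summable.of_norm (by simpa [norm_ex] using Decay.summable (p := 0) hc)

theorem norm_series_le {M : ℝ} {c : ℤ → ℂ} (hc : Decay 2 M c) (x : ℝ) :
    ‖series c x‖ ≤ M * wtSum := by
  have hs := Decay.summable (p := 0) hc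
  have ht := Decay.tsum_le (p := 0) hc
  simp only [pow_zero, one_mul] at hs ht
  refine (norm_tsum_le_tsum_norm ?_).trans (le_of_eq_of_le ?_ ht) <;> simp [norm_ex, hs]

theorem H_series {a M : ℝ} (ha : 0 < a) {f : ℝ → ℝ} (hf : SmoothPeriodic f) {c : ℤ → ℂ}
    (hc : Decay 3 M c) (hfc : ∀ x, (f x : ℂ) = series c x) (x : ℝ) :
    (H a f x : ℂ) = series (fun l => -(Complex.I * (symb a l : ℂ)) * c l) x := by
  have hc2 : Decay 2 M c := hc.mono (by norm_num) le_rfl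
  rw [(H_eq_integral ha hf x).2, ← integral_complex_ofReal]
  set F : ℤ → ℝ → ℂ := fun l y =>
    -(Complex.I * 2) * c l * ex l x * ((Real.sin (l * y) * K a y : ℝ) : ℂ) with hF
  have hint : ∀ l, Integrable (F l) (volume.restrict (Ioi 0)) := fun l =>
    ((integrableOn_sin_mul_K ha l).ofReal).const_mul _
  -- The crude bound |sin(ly)| ≤ |l| y suffices to exchange sum and integral: the lost factor |l| is
  -- paid for by summability of `wt l * ‖c l‖`. The uniform symbol bound is not needed here.
  have hsum : Summable fun l => ∫ y in Ioi 0, ‖F l y‖ := by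
    refine Summable.of_nonneg_of_le (fun l => integral_nonneg fun y => norm_nonneg _) (fun l => ?_)
      (hc.summable_wiener.mul_right (2 / Real.pi * ∫ y, a ^ 2 / (y ^ 2 + a ^ 2)))
    have hb := (integrable_bump ha).const_mul (wt l * ‖c l‖ * (2 / Real.pi))
    calc _ ≤ ∫ y in Ioi 0, wt l * ‖c l‖ * (2 / Real.pi) * (a ^ 2 / (y ^ 2 + a ^ 2)) := by
          refine setIntegral_mono_on (hint l).norm hb.integrableOn measurableSet_Ioi fun y hy => ?_
          have h1 := abs_mul_K_le (a := a) hy (abs_sin_mul_le l hy)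
          simp only [hF, norm_mul, norm_neg, Complex.norm_I, Complex.norm_ofNat, norm_ex,
            Complex.norm_real, Real.norm_eq_abs, one_mul, mul_one]
          rw [← abs_mul]
          calc _ ≤ 2 * ‖c l‖ * (wt l / Real.pi * (a ^ 2 / (y ^ 2 + a ^ 2))) := by
                have hp := Real.pi_pos
                gcongr
                refine h1.trans ?_
                gcongr
                exact abs_le_wt l
            _ = _ := by ring
      _ ≤ ∫ y, wt l * ‖c l‖ * (2 / Real.pi) * (a ^ 2 / (y ^ 2 + a ^ 2)) := by
          refine setIntegral_le_integral hb (Eventually.of_forall fun y => ?_)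
          have := wt_pos l
          have := Real.pi_pos
          positivity
      _ = _ := by rw [integral_const_mul]; ring
  have h := hasSum_integral_of_summable_integral_norm hint hsum
  have h1 : ∀ y, ∑' l, F l y = (((f (x - y) - f (x + y)) * K a y : ℝ) : ℂ) := fun y => by
    push_cast
    rw [hfc, hfc, series, series,
      ← (hc2.summable_series (x - y)).tsum_sub (hc2.summable_series (x + y)), ← tsum_mul_right]
    refine tsum_congr fun l => ?_
    have := ex_neg_sub_ex l y
    rw [sub_eq_add_neg x y, ex_add, ex_add, ← mul_sub, ← mul_sub, this, hF]
    push_cast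
    ring
  have h2 : ∀ l : ℤ, ∫ y in Ioi 0, F l y = -(Complex.I * (symb a l : ℂ)) * c l * ex l x :=
    fun l => by
      simp only [hF]
      rw [integral_const_mul, integral_complex_ofReal, symb]
      push_cast
      ring
  simp only [h1, h2] at h
  exact h.tsum_eq.symm

/-! ### Fourier coefficients of smooth periodic functions -/

theorem ex_two_pi (k : ℤ) : ex k (2 * Real.pi) = 1 := by
  rw [ex, show Complex.I * k * ((2 * Real.pi : ℝ) : ℂ) = k * (2 * Real.pi * Complex.I) by
    push_cast; ring]
  exact Complex.exp_int_mul_two_pi_mul_I k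

theorem ex_zero_right (k : ℤ) : ex k 0 = 1 := by simp [ex]

theorem ex_zero_left (x : ℝ) : ex 0 x = 1 := by simp [ex]

theorem periodic_ex (k : ℤ) : Function.Periodic (ex k) (2 * Real.pi) := fun x => by
  rw [ex_add, ex_two_pi, mul_one]

theorem integral_ex (k : ℤ) :
    ∫ x in (0 : ℝ)..2 * Real.pi, ex k x = if k = 0 then ((2 * Real.pi : ℝ) : ℂ) else 0 := by
  split_ifs with h
  · simp [h, ex_zero_left]
  · have hk : Complex.I * (k : ℂ) ≠ 0 := mul_ne_zero Complex.I_ne_zero (by exact_mod_cast h)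
    have h1 := intervalIntegral.integral_eq_sub_of_hasDerivAt (a := 0) (b := 2 * Real.pi)
      (fun x _ => (hasDerivAt_ex k x)) ((continuous_const.mul (continuous_ex k)).intervalIntegrable _ _)
    rw [intervalIntegral.integral_const_mul, ex_two_pi, ex_zero_right, sub_self] at h1
    exact (mul_eq_zero.1 h1).resolve_left hk

/-- The Fourier coefficients of a `2π`-periodic function. -/
noncomputable def coef (f : ℝ → ℝ) (k : ℤ) : ℂ :=
  ((2 * Real.pi : ℝ) : ℂ)⁻¹ * ∫ x in (0 : ℝ)..2 * Real.pi, ex (-k) x * f x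

theorem two_pi_ne_zero : ((2 * Real.pi : ℝ) : ℂ) ≠ 0 := by
  exact_mod_cast Real.two_pi_pos.ne'

theorem norm_coef_le {f : ℝ → ℝ} {M : ℝ} (hf : ∀ x, |f x| ≤ M) (k : ℤ) : ‖coef f k‖ ≤ M := by
  have hp := Real.two_pi_pos
  have h := intervalIntegral.norm_integral_le_of_norm_le_const (a := 0) (b := 2 * Real.pi)
    (f := fun x => ex (-k) x * f x) (C := M) fun x _ => by
      rw [norm_mul, norm_ex, one_mul, Complex.norm_real]
      exact hf x
  rw [coef, norm_mul, norm_inv, Complex.norm_real, Real.norm_of_nonneg hp.le,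
    inv_mul_le_iff₀ hp]
  rw [sub_zero, abs_of_pos hp] at h
  linarith

theorem coef_sub {f h : ℝ → ℝ} (hf : Continuous f) (hh : Continuous h) (k : ℤ) :
    coef (fun x => f x - h x) k = coef f k - coef h k := by
  have := continuous_ex (-k)
  rw [coef, coef, coef, ← mul_sub, ← intervalIntegral.integral_sub]
  · congr 2
    funext x
    push_cast
    ring
  · exact Continuous.intervalIntegrable (by fun_prop) _ _
  · exact Continuous.intervalIntegrable (by fun_prop) _ _

/-- Orthogonality of exponentials, integrated term by term; it turns a pointwise identity with a
series into an identity of coefficients. -/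
theorem coef_series {f : ℝ → ℝ} {c : ℤ → ℂ} {M : ℝ} (hc : Decay 2 M c)
    (hf : ∀ x, (f x : ℂ) = series c x) : coef f = c := by
  funext k
  have hs := Decay.summable (p := 0) hc
  have h := intervalIntegral.hasSum_integral_of_dominated_convergence (a := 0) (b := 2 * Real.pi)
    (μ := volume) (F := fun l x => c l * ex (l - k) x) (f := fun x => ex (-k) x * f x)
    (fun l _ => ‖c l‖)
    (fun l => ((continuous_const.mul (continuous_ex _)).aestronglyMeasurable))
    (fun l => Eventually.of_forall fun x _ => by simp [norm_ex])
    (Eventually.of_forall fun x _ => by simpa using hs)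
    intervalIntegrable_const
    (Eventually.of_forall fun x _ => by
      rw [hf]
      have := (hc.summable_series x).hasSum.mul_left (ex (-k) x)
      refine this.congr_fun fun l => ?_
      rw [sub_eq_add_neg, ex_add_left]
      ring)
  simp only [intervalIntegral.integral_const_mul, integral_ex, sub_eq_zero] at h
  rw [coef, ← h.tsum_eq, tsum_eq_single k fun l hl => by simp [hl]]
  rw [if_pos rfl]
  have := two_pi_ne_zero
  field_simp

theorem SmoothPeriodic.deriv {f : ℝ → ℝ} (hf : SmoothPeriodic f) : SmoothPeriodic (deriv f) := by
  refine ⟨((contDiff_infty_iff_deriv).1 hf.smooth).2, fun x => ?_⟩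
  rw [← deriv_comp_add_const, show (fun x => f (x + 2 * Real.pi)) = f from funext hf.periodic]

theorem SmoothPeriodic.iteratedDeriv {f : ℝ → ℝ} (hf : SmoothPeriodic f) (n : ℕ) :
    SmoothPeriodic (iteratedDeriv n f) := by
  induction n with
  | zero => simpa using hf
  | succ n ih => rw [iteratedDeriv_succ]; exact ih.deriv

theorem SmoothPeriodic.sub {f h : ℝ → ℝ} (hf : SmoothPeriodic f) (hh : SmoothPeriodic h) :
    SmoothPeriodic (fun x => f x - h x) :=
  ⟨hf.smooth.sub hh.smooth, fun x => by simp only [hf.periodic x, hh.periodic x]⟩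

theorem SmoothPeriodic.coef_deriv {f : ℝ → ℝ} (hf : SmoothPeriodic f) :
    coef (_root_.deriv f) = dx (coef f) := by
  funext k
  have hd := hf.deriv.smooth.continuous
  have h := intervalIntegral.integral_mul_deriv_eq_deriv_mul (a := 0) (b := 2 * Real.pi)
    (u := ex (-k)) (v := fun x => (f x : ℂ)) (u' := fun x => Complex.I * ((-k : ℤ) : ℂ) * ex (-k) x)
    (v' := fun x => ((_root_.deriv f x : ℝ) : ℂ))
    (fun x _ => hasDerivAt_ex _ x)
    (fun x _ => ((hf.smooth.differentiable (by simp)) x).hasDerivAt.ofReal_comp)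
    ((continuous_const.mul (continuous_ex _)).intervalIntegrable _ _)
    (Continuous.intervalIntegrable (by fun_prop) _ _)
  rw [ex_two_pi, ex_zero_right, show f (2 * Real.pi) = f 0 by simpa using hf.periodic 0,
    sub_self, zero_sub] at h
  simp only [mul_assoc, intervalIntegral.integral_const_mul] at h
  rw [coef, h, dx, coef]
  push_cast
  ring

theorem SmoothPeriodic.coef_iteratedDeriv {f : ℝ → ℝ} (hf : SmoothPeriodic f) (n : ℕ) (k : ℤ) :
    coef (_root_.iteratedDeriv n f) k = (Complex.I * k) ^ n * coef f k := by
  induction n generalizing k with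
  | zero => simp
  | succ n ih =>
    rw [iteratedDeriv_succ, (hf.iteratedDeriv n).coef_deriv, dx, ih, pow_succ]
    ring

/-- Integrating by parts p times yields |k|^p; the factor 2^p comes from 1 + |k| ≤ 2|k| for k ≠ 0,
and k = 0 is covered by the bound on `f` itself. -/
theorem SmoothPeriodic.decay_coef {f : ℝ → ℝ} (hf : SmoothPeriodic f) {p : ℕ} {M : ℝ}
    (h0 : ∀ x, |f x| ≤ M) (hp : ∀ x, |_root_.iteratedDeriv p f x| ≤ M) :
    Decay p (2 ^ p * M) (coef f) := fun k => by
  have hM : 0 ≤ M := (abs_nonneg _).trans (h0 0)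
  rcases eq_or_ne k 0 with rfl | hk
  · simp only [wt, Int.cast_zero, abs_zero, add_zero, one_pow]
    exact mul_le_mul (one_le_pow₀ one_le_two) (norm_coef_le h0 0) (norm_nonneg _) (by positivity)
  · have h1 : (1 : ℝ) ≤ |(k : ℝ)| := by exact_mod_cast Int.one_le_abs hk
    have h2 := norm_coef_le hp k
    rw [hf.coef_iteratedDeriv, norm_mul, norm_pow, norm_mul, Complex.norm_I, one_mul,
      Complex.norm_intCast] at h2
    calc _ ≤ (2 * |(k : ℝ)|) ^ p * ‖coef f k‖ := by
          have := wt_pos k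
          gcongr
          unfold wt
          linarith
      _ = 2 ^ p * (|(k : ℝ)| ^ p * ‖coef f k‖) := by ring
      _ ≤ _ := by gcongr

theorem SmoothPeriodic.exists_decay_coef {f : ℝ → ℝ} (hf : SmoothPeriodic f) (p : ℕ) :
    ∃ M, Decay p M (coef f) := by
  obtain ⟨M₀, -, h₀⟩ := hf.exists_bound
  obtain ⟨M₁, -, h₁⟩ := (hf.iteratedDeriv p).exists_bound
  exact ⟨_, hf.decay_coef (fun x => (h₀ x).trans (le_max_left _ _))
    fun x => (h₁ x).trans (le_max_right M₀ M₁)⟩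

theorem SmoothPeriodic.eq_series {f : ℝ → ℝ} (hf : SmoothPeriodic f) (x : ℝ) :
    (f x : ℂ) = series (coef f) x := by
  have : Fact (0 < 2 * Real.pi) := ⟨Real.two_pi_pos⟩
  have hper : Function.Periodic (fun x => (f x : ℂ)) (2 * Real.pi) := fun x => by
    simp only [hf.periodic x]
  have hcont : Continuous (hper.lift : AddCircle (2 * Real.pi) → ℂ) :=
    continuous_coinduced_dom.2 (Complex.continuous_ofReal.comp hf.smooth.continuous)
  have hfour : ∀ (k : ℤ) (y : ℝ), fourier k (y : AddCircle (2 * Real.pi)) = ex k y := fun k y => by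
    rw [fourier_coe_apply, ex]
    congr 1
    have := Real.pi_ne_zero
    push_cast
    field_simp
  have hcoef : ∀ k, fourierCoeff (hper.lift : AddCircle (2 * Real.pi) → ℂ) k = coef f k := fun k => by
    rw [fourierCoeff_eq_intervalIntegral _ k 0, zero_add, coef]
    simp only [hfour, Function.Periodic.lift_coe, smul_eq_mul, Complex.real_smul]
    push_cast
    rw [one_div]
  obtain ⟨M, hM⟩ := hf.exists_decay_coef 2
  have hs := has_pointwise_sum_fourier_series_of_summable
    (f := (⟨hper.lift, hcont⟩ : C(AddCircle (2 * Real.pi), ℂ)))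
    (by
      refine Summable.of_norm ?_
      simpa [hcoef] using Decay.summable (p := 0) hM) (x : AddCircle (2 * Real.pi))
  simp only [ContinuousMap.coe_mk, hcoef, hfour, Function.Periodic.lift_coe, smul_eq_mul] at hs
  exact hs.tsum_eq.symm

theorem SmoothPeriodic.abs_le {f : ℝ → ℝ} (hf : SmoothPeriodic f) {M : ℝ}
    (hM : Decay 2 M (coef f)) (x : ℝ) : |f x| ≤ M * wtSum := by
  rw [← Real.norm_eq_abs, ← Complex.norm_real, hf.eq_series x]
  exact norm_series_le hM x

theorem series_mul {M M' : ℝ} {u d : ℤ → ℂ} (hu : Decay 2 M u) (hd : Decay 2 M' d) (x : ℝ) :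
    series u x * series d x = series (conv u d) x := by
  have h1 : Summable fun k => ‖u k * ex k x‖ := (hu.summable_series x).norm
  have h2 : Summable fun k => ‖d k * ex k x‖ := (hd.summable_series x).norm
  let e : ℤ × ℤ ≃ ℤ × ℤ :=
    { toFun := fun p => (p.1 - p.2, p.2)
      invFun := fun p => (p.1 + p.2, p.2)
      left_inv := fun p => by simp
      right_inv := fun p => by simp }
  have h3 := e.summable_iff.2 (summable_mul_of_summable_norm h1 h2)
  rw [series, series, tsum_mul_tsum_of_summable_norm h1 h2, ← e.tsum_eq]
  have h4 := h3.tsum_prod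
  simp only [Function.comp_def] at h4
  rw [h4, series]
  refine tsum_congr fun k => ?_
  rw [conv, ← tsum_mul_right]
  refine tsum_congr fun j => ?_
  have : ex k x = ex (k - j) x * ex j x := by rw [← ex_add_left, sub_add_cancel]
  rw [this]
  simp only [e, Equiv.coe_fn_mk]
  ring

/-! ### Joint smoothness of Fourier series -/

section

/-- Continuous families of uniformly rapidly decaying sequences. -/
structure Rapid (I : Set ℝ) (c : ℝ → ℤ → ℂ) : Prop where
  cont : ∀ k, ContinuousOn (fun t => c t k) I
  decay : ∀ p, ∃ M, ∀ t ∈ I, Decay p M (c t)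

/-- Families of sequences with `n` derivatives in time, all of them rapidly decaying. -/
def RapidDiff (I : Set ℝ) : ℕ → (ℝ → ℤ → ℂ) → Prop
  | 0, c => Rapid I c
  | n + 1, c => Rapid I c ∧ ∃ c' : ℝ → ℤ → ℂ,
      (∀ t ∈ I, ∀ k, HasDerivAt (fun t => c t k) (c' t k) t) ∧ RapidDiff I n c'

variable {I : Set ℝ} {c d : ℝ → ℤ → ℂ} {n : ℕ}

theorem RapidDiff.rapid (h : RapidDiff I n c) : Rapid I c := by
  cases n with
  | zero => exact h
  | succ n => exact h.1

theorem RapidDiff.of_succ (h : RapidDiff I (n + 1) c) : RapidDiff I n c := by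
  induction n generalizing c with
  | zero => exact h.1
  | succ n ih =>
    obtain ⟨h1, c', h2, h3⟩ := h
    exact ⟨h1, c', h2, ih h3⟩

theorem Rapid.mul {m : ℤ → ℂ} {q : ℕ} {B : ℝ} (hB : 0 ≤ B) (hm : ∀ k, ‖m k‖ ≤ B * wt k ^ q)
    (h : Rapid I c) : Rapid I (fun t k => m k * c t k) where
  cont k := continuousOn_const.mul (h.cont k)
  decay p := by
    obtain ⟨M, hM⟩ := h.decay (p + q)
    exact ⟨B * M, fun t ht => (hM t ht).mul_left hB hm⟩

theorem RapidDiff.mul {m : ℤ → ℂ} {q : ℕ} {B : ℝ} (hB : 0 ≤ B) (hm : ∀ k, ‖m k‖ ≤ B * wt k ^ q)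
    (h : RapidDiff I n c) : RapidDiff I n (fun t k => m k * c t k) := by
  induction n generalizing c with
  | zero => exact Rapid.mul hB hm h
  | succ n ih =>
    obtain ⟨h1, c', h2, h3⟩ := h
    exact ⟨h1.mul hB hm, _, fun t ht k => (h2 t ht k).const_mul _, ih h3⟩

theorem RapidDiff.dx (h : RapidDiff I n c) : RapidDiff I n (fun t => dx (c t)) :=
  RapidDiff.mul (m := fun k => Complex.I * k) (q := 1) zero_le_one
    (fun k => by simpa using abs_le_wt k) h

theorem RapidDiff.neg (h : RapidDiff I n c) : RapidDiff I n (fun t k => -c t k) := by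
  simpa using RapidDiff.mul (m := fun _ => -1) (q := 0) zero_le_one (by simp) h

theorem RapidDiff.conjReflect (h : RapidDiff I n c) :
    RapidDiff I n (fun t k => starRingEnd ℂ (c t (-k))) := by
  have hr : ∀ {c : ℝ → ℤ → ℂ}, Rapid I c → Rapid I (fun t k => starRingEnd ℂ (c t (-k))) :=
    fun h => ⟨fun k => Complex.continuous_conj.comp_continuousOn (h.cont (-k)), fun p => by
      obtain ⟨M, hM⟩ := h.decay p
      exact ⟨M, fun t ht => (hM t ht).conjReflect⟩⟩
  induction n generalizing c with
  | zero => exact hr h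
  | succ n ih =>
    obtain ⟨h1, c', h2, h3⟩ := h
    exact ⟨hr h1, _, fun t ht k => (h2 t ht (-k)).star, ih h3⟩

theorem RapidDiff.add (h : RapidDiff I n c) (h' : RapidDiff I n d) :
    RapidDiff I n (fun t k => c t k + d t k) := by
  have hr : ∀ {c d : ℝ → ℤ → ℂ}, Rapid I c → Rapid I d → Rapid I (fun t k => c t k + d t k) :=
    fun h h' => ⟨fun k => (h.cont k).add (h'.cont k), fun p => by
      obtain ⟨M, hM⟩ := h.decay p
      obtain ⟨M', hM'⟩ := h'.decay p
      exact ⟨M + M', fun t ht => (hM t ht).add (hM' t ht)⟩⟩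
  induction n generalizing c d with
  | zero => exact hr h h'
  | succ n ih =>
    obtain ⟨h1, c', h2, h3⟩ := h
    obtain ⟨h1', d', h2', h3'⟩ := h'
    exact ⟨hr h1 h1', _, fun t ht k => (h2 t ht k).add (h2' t ht k), ih h3 h3'⟩

theorem Rapid.conv (h : Rapid I c) (h' : Rapid I d) : Rapid I (fun t => conv (c t) (d t)) where
  cont k := by
    obtain ⟨M, hM⟩ := h.decay 0
    obtain ⟨M', hM'⟩ := h'.decay 2
    refine continuousOn_tsum (fun j => (h.cont (k - j)).mul (h'.cont j))
      (summable_inv_wt_sq.mul_left (M * M')) fun j t ht => ?_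
    simpa using norm_conv_term_le (p := 0) (hM t ht) (hM' t ht) k j
  decay p := by
    obtain ⟨M, hM⟩ := h.decay p
    obtain ⟨M', hM'⟩ := h'.decay (p + 2)
    exact ⟨_, fun t ht => (hM t ht).conv (hM' t ht)⟩

theorem Rapid.hasDerivAt_conv (hI : IsOpen I) (hI' : IsPreconnected I) {c' d' : ℝ → ℤ → ℂ}
    (hc : Rapid I c) (hd : Rapid I d) (hc' : Rapid I c') (hd' : Rapid I d')
    (h : ∀ t ∈ I, ∀ k, HasDerivAt (fun t => c t k) (c' t k) t)
    (h' : ∀ t ∈ I, ∀ k, HasDerivAt (fun t => d t k) (d' t k) t) {t : ℝ} (ht : t ∈ I) (k : ℤ) :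
    HasDerivAt (fun t => IPM.conv (c t) (d t) k)
      (IPM.conv (c' t) (d t) k + IPM.conv (c t) (d' t) k) t := by
  obtain ⟨M₁, h₁⟩ := hc.decay 0
  obtain ⟨M₂, h₂⟩ := hd.decay 2
  obtain ⟨M₃, h₃⟩ := hc'.decay 0
  obtain ⟨M₄, h₄⟩ := hd'.decay 2
  have key := hasDerivAt_tsum_of_isPreconnected (g := fun j t => c t (k - j) * d t j)
    (g' := fun j t => c' t (k - j) * d t j + c t (k - j) * d' t j)
    (summable_inv_wt_sq.mul_left (M₃ * M₂ + M₁ * M₄)) hI hI'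
    (fun j t ht => (h t ht (k - j)).mul (h' t ht j))
    (fun j t ht => by
      have a1 := norm_conv_term_le (p := 0) (h₃ t ht) (h₂ t ht) k j
      have a2 := norm_conv_term_le (p := 0) (h₁ t ht) (h₄ t ht) k j
      rw [pow_zero, one_mul] at a1 a2
      exact (norm_add_le _ _).trans ((add_le_add a1 a2).trans_eq (by ring)))
    ht (summable_conv (h₁ t ht) (h₂ t ht) k) ht
  rwa [(summable_conv (h₃ t ht) (h₂ t ht) k).tsum_add (summable_conv (h₁ t ht) (h₄ t ht) k)] at key

theorem RapidDiff.conv (hI : IsOpen I) (hI' : IsPreconnected I) (h : RapidDiff I n c)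
    (h' : RapidDiff I n d) : RapidDiff I n (fun t => IPM.conv (c t) (d t)) := by
  induction n generalizing c d with
  | zero => exact Rapid.conv h h'
  | succ n ih =>
    have hc := h.of_succ
    have hd := h'.of_succ
    obtain ⟨h1, c', h2, h3⟩ := h
    obtain ⟨h1', d', h2', h3'⟩ := h'
    exact ⟨h1.conv h1', _, fun t ht k => h1.hasDerivAt_conv hI hI' h1' h3.rapid h3'.rapid h2 h2' ht k,
      (ih h3 hd).add (ih hc h3')⟩

theorem RapidDiff.vel {μ : ℤ → ℂ} {B : ℝ} (hμ : IsMult μ B) (h : RapidDiff I n c) :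
    RapidDiff I n (fun t => vel μ (c t)) := by
  have h1 := RapidDiff.mul (m := fun k => μ k / 2) (q := 0) hμ.nonneg (fun k => by
    rw [norm_div, pow_zero, mul_one]
    norm_num
    linarith [hμ.bound k, hμ.nonneg]) (h.add h.conjReflect)
  have h2 : (fun t k => μ k / 2 * (c t k + starRingEnd ℂ (c t (-k)))) = fun t => IPM.vel μ (c t) := by
    funext t k
    rw [IPM.vel]
    ring
  rwa [h2] at h1

/-- Bootstrap in time: the right-hand side is made of operations preserving `RapidDiff`, so n time
derivatives of `c` give n of c', hence n + 1 of `c`. -/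
theorem rapidDiff_of_solution {μ : ℤ → ℂ} {B : ℝ} (hμ : IsMult μ B) (hI : IsOpen I)
    (hI' : IsPreconnected I) (h : Rapid I c)
    (hd : ∀ t ∈ I, ∀ k, HasDerivAt (fun t => c t k) (rhs μ (c t) k) t) (n : ℕ) :
    RapidDiff I n c := by
  induction n with
  | zero => exact h
  | succ n ih => exact ⟨h, _, hd, (RapidDiff.conv hI hI' (ih.vel hμ) ih.dx).neg⟩

theorem Rapid.hasFDerivAt_series (hI : IsOpen I) (hI' : IsPreconnected I) {c' : ℝ → ℤ → ℂ}
    (hc : Rapid I c) (hc' : Rapid I c')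
    (h : ∀ t ∈ I, ∀ k, HasDerivAt (fun t => c t k) (c' t k) t) {p : ℝ × ℝ} (hp : p.1 ∈ I) :
    HasFDerivAt (fun p : ℝ × ℝ => series (c p.1) p.2)
      ((ContinuousLinearMap.fst ℝ ℝ ℝ).smulRight (series (c' p.1) p.2) +
        (ContinuousLinearMap.snd ℝ ℝ ℝ).smulRight (series (IPM.dx (c p.1)) p.2)) p := by
  obtain ⟨M₁, h₁⟩ := hc.decay 3
  obtain ⟨M₂, h₂⟩ := hc'.decay 2
  have hterm : ∀ (k : ℤ) (q : ℝ × ℝ), q ∈ I ×ˢ (univ : Set ℝ) →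
      HasFDerivAt (fun q : ℝ × ℝ => c q.1 k * ex k q.2)
        ((ContinuousLinearMap.fst ℝ ℝ ℝ).smulRight (c' q.1 k * ex k q.2) +
          (ContinuousLinearMap.snd ℝ ℝ ℝ).smulRight (IPM.dx (c q.1) k * ex k q.2)) q := by
    intro k q hq
    have a1 := (h q.1 hq.1 k).hasFDerivAt.comp q (hasFDerivAt_fst (𝕜 := ℝ) (p := q))
    have a2 := (hasDerivAt_ex k q.2).hasFDerivAt.comp q (hasFDerivAt_snd (𝕜 := ℝ) (p := q))
    convert! a1.mul a2 using 1
    ext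
    · simp [IPM.dx]
      ring
    · simp [IPM.dx]
      ring
  have key := hasFDerivAt_tsum_of_isPreconnected
    (summable_inv_wt_sq.mul_left (M₂ + M₁)) (hI.prod isOpen_univ)
    (hI'.prod isPreconnected_univ) hterm (fun k q hq => ?_) (x₀ := p) ⟨hp, mem_univ _⟩
    (((h₁ p.1 hp).mono (by norm_num) le_rfl).summable_series p.2) (x := p) ⟨hp, mem_univ _⟩
  · have s1 := ((h₂ p.1 hp).summable_series p.2).hasSum
    have s2 := ((Decay.dx (h₁ p.1 hp)).summable_series p.2).hasSum
    have := ((ContinuousLinearMap.smulRightL ℝ (ℝ × ℝ) ℂ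
      (ContinuousLinearMap.fst ℝ ℝ ℝ)).hasSum s1).add ((ContinuousLinearMap.smulRightL ℝ (ℝ × ℝ) ℂ
      (ContinuousLinearMap.snd ℝ ℝ ℝ)).hasSum s2)
    convert! key using 1
    exact this.tsum_eq.symm
  · have b1 := (h₂ q.1 hq.1).weight_le (p := 0) k
    have b2 := (Decay.dx (h₁ q.1 hq.1)).weight_le (p := 0) k
    rw [pow_zero, one_mul] at b1 b2
    refine (norm_add_le _ _).trans ?_
    rw [ContinuousLinearMap.norm_smulRight_apply, ContinuousLinearMap.norm_smulRight_apply,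
      norm_mul, norm_mul, norm_ex, mul_one, mul_one, add_mul]
    exact add_le_add ((mul_le_of_le_one_left (norm_nonneg _)
      (ContinuousLinearMap.norm_fst_le ℝ ℝ ℝ)).trans b1) ((mul_le_of_le_one_left (norm_nonneg _)
      (ContinuousLinearMap.norm_snd_le ℝ ℝ ℝ)).trans b2)

/-- Both partial derivatives are again series of the same kind: in t with coefficients `c'`, in x
with coefficients `dx c`. Space derivatives cost only decay, which is unlimited, so induction on the
number of time derivatives covers joint smoothness. -/
theorem RapidDiff.contDiffOn_series (hI : IsOpen I) (hI' : IsPreconnected I)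
    (h : RapidDiff I n c) :
    ContDiffOn ℝ n (fun p : ℝ × ℝ => series (c p.1) p.2) (I ×ˢ univ) := by
  induction n generalizing c with
  | zero =>
    obtain ⟨M, hM⟩ := h.rapid.decay 2
    refine contDiffOn_zero.2 (continuousOn_tsum (fun k => ContinuousOn.mul ?_ ?_)
      (summable_inv_wt_sq.mul_left M) fun k p hp => ?_)
    · exact (h.rapid.cont k).comp continuousOn_fst fun p hp => hp.1
    · exact ((continuous_ex k).comp continuous_snd).continuousOn
    · simpa [norm_ex] using (hM p.1 hp.1).weight_le (p := 0) k
  | succ n ih =>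
    have hlow := h.of_succ
    obtain ⟨h1, c', h2, h3⟩ := h
    have hD := fun (p : ℝ × ℝ) (hp : p ∈ I ×ˢ (univ : Set ℝ)) =>
      h1.hasFDerivAt_series hI hI' h3.rapid h2 hp.1
    have hopen : IsOpen (I ×ˢ (univ : Set ℝ)) := hI.prod isOpen_univ
    have := (contDiffOn_succ_iff_fderiv_of_isOpen (𝕜 := ℝ) (n := n) hopen).2
      ⟨fun p hp => (hD p hp).differentiableAt.differentiableWithinAt, by simp,
        ContDiffOn.congr ((contDiffOn_const.smulRight (ih h3)).add
          (contDiffOn_const.smulRight (ih hlow.dx))) fun p hp => (hD p hp).fderiv⟩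
    exact_mod_cast this

end

/-! ### Local existence -/

theorem Decay.hermPart {p : ℕ} {M : ℝ} {c : ℤ → ℂ} (hc : Decay p M c) :
    Decay p M (fun k => (c k + starRingEnd ℂ (c (-k))) / 2) := fun k => by
  have := (hc.add hc.conjReflect) k
  rw [norm_div, Complex.norm_ofNat]
  linarith

theorem ofReal_re_series {M : ℝ} {c : ℤ → ℂ} (hc : Decay 2 M c) (x : ℝ) :
    (((series c x).re : ℝ) : ℂ) = series (fun k => (c k + starRingEnd ℂ (c (-k))) / 2) x := by
  have h1 := hc.summable_series x
  have h2 := hc.conjReflect.summable_series x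
  have h3 : starRingEnd ℂ (series c x) = ∑' k, starRingEnd ℂ (c (-k)) * ex k x := by
    rw [series, Complex.conj_tsum, ← (Equiv.neg ℤ).tsum_eq]
    simp [conj_ex]
  have h4 : (((series c x).re : ℝ) : ℂ) = (series c x + starRingEnd ℂ (series c x)) / 2 := by
    rw [Complex.add_conj]
    push_cast
    ring
  rw [h4, h3, series, series, ← h1.tsum_add h2, ← tsum_div_const]
  exact tsum_congr fun k => by ring

theorem H_re_series {a g M : ℝ} (ha : 0 < a) {f : ℝ → ℝ} (hf : SmoothPeriodic f) {c : ℤ → ℂ}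
    (hc : Decay 3 M c) (hfc : ∀ x, f x = (series c x).re) (x : ℝ) :
    ((g * H a f x : ℝ) : ℂ) = series (vel (mult a g) c) x := by
  push_cast
  rw [H_series ha hf hc.hermPart (fun x => by
    rw [hfc, ofReal_re_series (hc.mono (by norm_num) le_rfl)]) x, series, series, ← tsum_mul_left]
  refine tsum_congr fun k => ?_
  rw [vel, mult]
  push_cast
  ring

/-- Local existence, with bounds of all orders on a common time interval. -/
theorem exists_isSolution {a g : ℝ} (ha : 0 < a) (hg : 0 < g) (R : ℝ) :
    ∃ T > 0, ∃ Φ : ℕ → ℝ → ℝ, ∀ σ₀ : ℝ → ℝ, SmoothPeriodic σ₀ → Decay 3 R (coef σ₀) →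
      ∃ σ : ℝ → ℝ → ℝ, IsSolution a g T σ₀ σ ∧
        ∀ s M, Decay (s + 1) M (coef σ₀) → ∀ t ∈ Ico 0 T, Decay s (Φ s M) (coef (σ t)) := by
  have hμ := isMult_mult ha hg
  obtain ⟨T, hT, Φ, hex⟩ := exists_coefficient_solution hμ R
  refine ⟨T, hT, Φ, fun σ₀ hσ₀ hR => ?_⟩
  obtain ⟨c, hc0, hder, hdec⟩ := hex (coef σ₀) hR hσ₀.exists_decay_coef
  set I := Ioo (-T) T with hI_def
  have hI : IsOpen I := isOpen_Ioo
  have hI' : IsPreconnected I := isPreconnected_Ioo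
  have hrapid : Rapid I c := ⟨fun k t ht => (hder t ht k).continuousAt.continuousWithinAt, fun p => by
    obtain ⟨M, hM⟩ := hσ₀.exists_decay_coef (p + 1)
    exact ⟨_, hdec p M hM⟩⟩
  have hn := rapidDiff_of_solution hμ hI hI' hrapid hder
  have hrhs : Rapid I (fun t => rhs (mult a g) (c t)) := by
    have h0 := hn 0
    exact (RapidDiff.conv (n := 0) hI hI' (h0.vel hμ) h0.dx).neg.rapid
  have hF := fun (p : ℝ × ℝ) (hp : p.1 ∈ I) => hrapid.hasFDerivAt_series hI hI' hrhs hder hp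
  have hsmooth : ContDiffOn ℝ ∞ (fun p : ℝ × ℝ => (series (c p.1) p.2).re) (I ×ˢ univ) := by
    have : ContDiffOn ℝ ∞ (fun p : ℝ × ℝ => series (c p.1) p.2) (I ×ˢ univ) :=
      contDiffOn_infty.2 fun n => (hn n).contDiffOn_series hI hI'
    exact Complex.reCLM.contDiff.comp_contDiffOn this
  have hper : ∀ t, Function.Periodic (fun x => (series (c t) x).re) (2 * Real.pi) := fun t x => by
    simp only [series, periodic_ex _ x]
  have hSP : ∀ t ∈ I, SmoothPeriodic (fun x => (series (c t) x).re) := fun t ht =>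
    ⟨contDiffOn_univ.1 (hsmooth.comp (f := fun x : ℝ => (t, x))
      (contDiff_const.prodMk contDiff_id).contDiffOn fun x _ => ⟨ht, mem_univ _⟩), hper t⟩
  -- The coefficients are known on an open interval around 0, so smoothness up to t = 0 and the
  -- one-sided derivative there are restrictions.
  have hsub : Ico 0 T ⊆ I := fun t ht => ⟨by linarith [ht.1], ht.2⟩
  have hdec2 : ∀ t ∈ I, ∃ M, Decay 3 M (c t) := fun t ht => by
    obtain ⟨M, hM⟩ := hrapid.decay 3
    exact ⟨M, hM t ht⟩
  refine ⟨fun t x => (series (c t) x).re, ⟨hsmooth.mono (prod_mono hsub subset_rfl),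
    fun t _ => hper t, ?_, fun t ht x => ?_⟩, fun s M hM t ht => ?_⟩
  · funext x
    rw [hc0, ← hσ₀.eq_series, Complex.ofReal_re]
  · have htI := hsub ht
    obtain ⟨M, hM⟩ := hdec2 t htI
    have h1 := (hF (t, x) htI).comp_hasDerivAt t ((hasDerivAt_id t).prodMk (hasDerivAt_const t x))
    have h2 := (hF (t, x) htI).comp_hasDerivAt x ((hasDerivAt_const x t).prodMk (hasDerivAt_id x))
    have h1' := (Complex.reCLM.hasFDerivAt).comp_hasDerivAt t h1
    have h2' := (Complex.reCLM.hasFDerivAt).comp_hasDerivAt x h2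
    have h3 : HasDerivAt (fun x => (series (c t) x).re) (series (dx (c t)) x).re x := by
      simpa [Function.comp_def] using h2'
    have h4 : HasDerivAt (fun s => (series (c s) x).re) (series (rhs (mult a g) (c t)) x).re t := by
      simpa [Function.comp_def] using h1'
    rw [h3.deriv]
    have h5 := H_re_series (g := g) ha (hSP t htI) hM (fun _ => rfl) x
    have h6 := series_mul (hM.mono (q := 2) (by norm_num) le_rfl |>.vel hμ) (Decay.dx hM) x
    have h7 : series (rhs (mult a g) (c t)) x =
        -(series (vel (mult a g) (c t)) x * series (dx (c t)) x) := by
      rw [h6]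
      simp only [series, rhs, neg_mul, tsum_neg]
    -- The velocity is real, so taking real parts commutes with multiplication by it.
    rw [h7, ← h5, Complex.neg_re, Complex.re_ofReal_mul] at h4
    exact h4.hasDerivWithinAt
  · obtain ⟨M', hM'⟩ := hdec2 t (hsub ht)
    have hM2 : Decay 2 M' (c t) := hM'.mono (by norm_num) le_rfl
    rw [coef_series hM2.hermPart (fun x => ofReal_re_series hM2 x)]
    exact (hdec s M hM t (hsub ht)).hermPart

/-! ### Stability and uniqueness -/

section

theorem summable_conj_mul {M M' : ℝ} {e F : ℤ → ℂ} (he : Decay 2 M e) (hF : Decay 0 M' F) :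
    Summable fun k => starRingEnd ℂ (e k) * F k :=
  Summable.of_norm_bounded (summable_inv_wt_sq.mul_left (M * M')) fun k => by
    have h1 := he.weight_le (p := 0) k
    have h2 := hF k
    rw [pow_zero, one_mul] at h1 h2
    rw [norm_mul, RCLike.norm_conj]
    exact (mul_le_mul h1 h2 (norm_nonneg _) ((norm_nonneg _).trans h1)).trans_eq (by ring)

/-- With w = c - d the difference is -(v_w ∂c + v_d ∂w). The first term has its derivative on the
known solution; the second is transport of `w` by a real velocity and is skew up to a bounded term.
Only L² of `w` appears. -/
theorem abs_re_rhs_sub_le {μ : ℤ → ℂ} {B M : ℝ} (hμ : IsMult μ B) {c d : ℤ → ℂ}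
    (hc : Decay 3 M c) (hd : Decay 3 M d) :
    |2 * (∑' k, starRingEnd ℂ (c k - d k) * (rhs μ c k - rhs μ d k)).re| ≤
      M * wtSum * (B + 1) ^ 2 * sob 0 (fun k => c k - d k) := by
  set w : ℤ → ℂ := fun k => c k - d k with hw_def
  have hw : Decay 3 (M + M) w := hc.sub hd
  have hB := hμ.nonneg
  have hvw := hw.vel hμ
  have hvd := hd.vel hμ
  have h3 : ∀ k, rhs μ c k - rhs μ d k =
      -(conv (vel μ w) (dx c) k + conv (vel μ d) (dx w) k) := fun k => by
    have := conv_sub_conv (((hc.mono (Nat.zero_le 3) le_rfl)).vel hμ) (Decay.dx (p := 2) hc)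
      (((hd.mono (Nat.zero_le 3) le_rfl)).vel hμ) (Decay.dx (p := 2) hd) k
    simp only [← vel_sub, ← dx_sub] at this
    rw [← this, rhs, rhs]
    ring
  have s1 := summable_conj_mul (hw.mono (q := 2) (by norm_num) le_rfl)
    ((hvw.mono (Nat.zero_le 3) le_rfl).conv (p := 0) (Decay.dx (p := 2) hc))
  have s2 := summable_conj_mul (hw.mono (q := 2) (by norm_num) le_rfl)
    ((hvd.mono (Nat.zero_le 3) le_rfl).conv (p := 0) (Decay.dx (p := 2) hw))
  have hsplit : ∑' k, starRingEnd ℂ (w k) * (rhs μ c k - rhs μ d k) =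
      -(∑' k, starRingEnd ℂ (w k) * conv (vel μ w) (dx c) k +
        ∑' k, starRingEnd ℂ (w k) * conv (vel μ d) (dx w) k) := by
    rw [← s1.tsum_add s2, ← tsum_neg]
    exact tsum_congr fun k => by rw [h3]; ring
  have b1 := abs_re_pairing_le hvw hc hw
  have b2 := abs_re_transport_le hvd hw (vel_neg hμ d)
  have b3 := sob_vel_le (s := 0) hμ (hw.mono (by norm_num) le_rfl)
  have b4 := (wiener_vel_le hμ hd).trans (mul_le_mul_of_nonneg_left hd.wiener_le hB)
  have b5 := hc.wiener_le
  have hS := sob_nonneg 0 w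
  have hMz := mul_nonneg hc.nonneg wtSum_nonneg
  rw [hsplit, Complex.neg_re, Complex.add_re, abs_mul, abs_neg, abs_two]
  -- The pairing contributes B² + 1 and the transport term 2B, which add up to (B + 1)².
  calc _ ≤ 2 * (M * wtSum * (B ^ 2 * sob 0 w + sob 0 w) / 2 + B * (M * wtSum) * sob 0 w) := by
        gcongr
        refine (abs_add_le _ _).trans (add_le_add (b1.trans ?_) (b2.trans ?_))
        · have := wiener_nonneg c
          have := sob_nonneg 0 (vel μ w)
          gcongr
        · gcongr
    _ = _ := by ring

/-- Stability in `L²` of solutions of the equation for the Fourier coefficients. -/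
theorem sob_zero_sub_le {μ : ℤ → ℂ} {B M T : ℝ} (hμ : IsMult μ B) {c d : ℝ → ℤ → ℂ}
    (hc : ∀ t ∈ Icc 0 T, Decay 3 M (c t)) (hd : ∀ t ∈ Icc 0 T, Decay 3 M (d t))
    (hcc : ∀ k, ContinuousOn (fun t => c t k) (Icc 0 T))
    (hdc : ∀ k, ContinuousOn (fun t => d t k) (Icc 0 T))
    (hc' : ∀ t ∈ Ioo 0 T, ∀ k, HasDerivAt (fun t => c t k) (rhs μ (c t) k) t)
    (hd' : ∀ t ∈ Ioo 0 T, ∀ k, HasDerivAt (fun t => d t k) (rhs μ (d t) k) t) :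
    ∀ t ∈ Icc 0 T, sob 0 (fun k => c t k - d t k) ≤
      sob 0 (fun k => c 0 k - d 0 k) * Real.exp (M * wtSum * (B + 1) ^ 2 * t) := by
  have hw : ∀ t ∈ Icc 0 T, Decay 3 (M + M) (fun k => c t k - d t k) := fun t ht =>
    (hc t ht).sub (hd t ht)
  have hr : ∀ t ∈ Icc 0 T, Decay 0 (B * M * M * wtSum + B * M * M * wtSum)
      (fun k => rhs μ (c t) k - rhs μ (d t) k) := fun t ht =>
    (((hc t ht).mono (Nat.zero_le 3) le_rfl).rhs hμ (hc t ht)).sub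
      (((hd t ht).mono (Nat.zero_le 3) le_rfl).rhs hμ (hd t ht))
  set M' := B * M * M * wtSum + B * M * M * wtSum
  have hcont : ContinuousOn (fun t => sob 0 (fun k => c t k - d t k)) (Icc 0 T) := by
    refine continuousOn_tsum (fun k => ?_) (summable_inv_wt_sq.mul_left ((M + M) ^ 2))
      fun k t ht => ?_
    · exact (continuousOn_const.mul ((hcc k).sub (hdc k)).norm).pow 2
    · rw [Real.norm_of_nonneg (sq_nonneg _)]
      exact ((hw t ht).mono (q := 1) (by norm_num) le_rfl).sq_le (s := 0) k
  have hderiv : ∀ t ∈ Ioo 0 T, HasDerivAt (fun t => sob 0 (fun k => c t k - d t k))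
      (2 * (∑' k, starRingEnd ℂ (c t k - d t k) * (rhs μ (c t) k - rhs μ (d t) k)).re) t := by
    intro t ht
    simp only [sob_zero]
    have hsum := fun t (ht : t ∈ Ioo 0 T) => summable_conj_mul
      ((hw t (Ioo_subset_Icc_self ht)).mono (q := 2) (by norm_num) le_rfl)
      (hr t (Ioo_subset_Icc_self ht))
    have key := hasDerivAt_tsum_of_isPreconnected (g := fun k t => ‖c t k - d t k‖ ^ 2)
      (g' := fun k t => 2 * (starRingEnd ℂ (c t k - d t k) * (rhs μ (c t) k - rhs μ (d t) k)).re)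
      (summable_inv_wt_sq.mul_left (2 * ((M + M) * M'))) isOpen_Ioo isPreconnected_Ioo
      (fun k t ht => ?_) (fun k t ht => ?_) ht
      (summable_norm_sq ((hw t (Ioo_subset_Icc_self ht)).mono (by norm_num) le_rfl)) ht
    · rw [tsum_mul_left, ← Complex.re_tsum (hsum t ht)] at key
      exact key
    · have := ((hc' t ht k).sub (hd' t ht k)).norm_sq
      convert! this using 1
      congr 1
      rw [Complex.inner, mul_comm]
      rfl
    · have h1 := ((hw t (Ioo_subset_Icc_self ht)).mono (q := 2) (by norm_num) le_rfl).weight_le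
        (p := 0) k
      have h2 := hr t (Ioo_subset_Icc_self ht) k
      rw [pow_zero, one_mul] at h1 h2
      rw [Real.norm_eq_abs, abs_mul, abs_two, mul_assoc]
      refine mul_le_mul_of_nonneg_left ((Complex.abs_re_le_norm _).trans ?_) zero_le_two
      rw [norm_mul, RCLike.norm_conj]
      exact (mul_le_mul h1 h2 (norm_nonneg _) ((norm_nonneg _).trans h1)).trans_eq (by ring)
  exact gronwall_le hcont hderiv fun t ht => (le_abs_self _).trans
    (abs_re_rhs_sub_le hμ (hc t (Ioo_subset_Icc_self ht)) (hd t (Ioo_subset_Icc_self ht)))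

theorem continuous_series {M : ℝ} {c : ℤ → ℂ} (hc : Decay 2 M c) : Continuous (series c) :=
  continuous_tsum (fun k => continuous_const.mul (continuous_ex k))
    (summable_inv_wt_sq.mul_left M) fun k x => by
      simpa [norm_ex] using hc.weight_le (p := 0) k

/-! ### Smooth solutions solve the equation for the Fourier coefficients -/

/-- On the half-open strip the within-derivative in the direction (0, 1) is the ordinary
x-derivative, since each time slice is a full line. -/
theorem contDiffOn_deriv_snd {T : ℝ} {ρ : ℝ → ℝ → ℝ}
    (h : ContDiffOn ℝ ∞ (fun p : ℝ × ℝ => ρ p.1 p.2) (Ico 0 T ×ˢ univ)) :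
    ContDiffOn ℝ ∞ (fun p : ℝ × ℝ => deriv (ρ p.1) p.2) (Ico 0 T ×ˢ univ) := by
  have hu : UniqueDiffOn ℝ (Ico 0 T ×ˢ (univ : Set ℝ)) :=
    (uniqueDiffOn_Ico 0 T).prod uniqueDiffOn_univ
  refine ((h.fderivWithin hu (m := ∞) (by simp)).clm_apply
    (contDiffOn_const (c := ((0 : ℝ), (1 : ℝ))))).congr fun p hp => ?_
  obtain ⟨t, x⟩ := p
  have h1 := (h.differentiableOn (by simp) (t, x) hp).hasFDerivWithinAt
  have h2 : HasDerivWithinAt (fun y : ℝ => (t, y)) ((0 : ℝ), (1 : ℝ)) univ x :=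
    ((hasDerivAt_const x t).prodMk (hasDerivAt_id x)).hasDerivWithinAt
  have h3 := h1.comp_hasDerivWithinAt x h2 fun y _ => ⟨hp.1, mem_univ _⟩
  exact (hasDerivWithinAt_univ.1 h3).deriv

theorem contDiffOn_iteratedDeriv_snd {T : ℝ} {ρ : ℝ → ℝ → ℝ}
    (h : ContDiffOn ℝ ∞ (fun p : ℝ × ℝ => ρ p.1 p.2) (Ico 0 T ×ˢ univ)) (n : ℕ) :
    ContDiffOn ℝ ∞ (fun p : ℝ × ℝ => iteratedDeriv n (ρ p.1) p.2) (Ico 0 T ×ˢ univ) := by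
  induction n with
  | zero => simpa using h
  | succ n ih =>
    simp only [iteratedDeriv_succ]
    exact contDiffOn_deriv_snd (ρ := fun t => iteratedDeriv n (ρ t)) ih

variable {a g T : ℝ} {ρ₀ : ℝ → ℝ} {ρ : ℝ → ℝ → ℝ}

theorem IsSolution.smoothPeriodic (h : IsSolution a g T ρ₀ ρ) {t : ℝ} (ht : t ∈ Ico 0 T) :
    SmoothPeriodic (ρ t) :=
  ⟨contDiffOn_univ.1 (h.smooth.comp (f := fun x : ℝ => (t, x))
    (contDiff_const.prodMk contDiff_id).contDiffOn fun _ _ => ⟨ht, mem_univ _⟩), h.periodic t ht⟩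

/-- By periodicity it is enough to use compactness of [0, T'] × [0, 2π]. The restriction T' < T
matters, as nothing is assumed about the solution near T. -/
theorem IsSolution.exists_bound_iteratedDeriv (h : IsSolution a g T ρ₀ ρ) {T' : ℝ} (hT' : T' < T)
    (n : ℕ) : ∃ M, ∀ t ∈ Icc 0 T', ∀ x, |iteratedDeriv n (ρ t) x| ≤ M := by
  have hK : IsCompact (Icc (0 : ℝ) T' ×ˢ Icc (0 : ℝ) (2 * Real.pi)) :=
    isCompact_Icc.prod isCompact_Icc
  have hsub : ∀ t ∈ Icc 0 T', t ∈ Ico 0 T := fun t ht => ⟨ht.1, lt_of_le_of_lt ht.2 hT'⟩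
  obtain ⟨M, hM⟩ := hK.exists_bound_of_continuousOn
    ((contDiffOn_iteratedDeriv_snd h.smooth n).continuousOn.mono
      fun p hp => ⟨hsub _ hp.1, mem_univ _⟩)
  refine ⟨M, fun t ht x => ?_⟩
  obtain ⟨y, hy, hxy⟩ := (((h.smoothPeriodic (hsub t ht)).iteratedDeriv n).periodic).exists_mem_Ico₀
    Real.two_pi_pos x
  rw [hxy]
  exact hM (t, y) ⟨ht, Ico_subset_Icc_self hy⟩

theorem IsSolution.exists_decay (h : IsSolution a g T ρ₀ ρ) {T' : ℝ} (hT' : T' < T)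
    (p : ℕ) : ∃ M, ∀ t ∈ Icc 0 T', Decay p M (coef (ρ t)) := by
  obtain ⟨M₀, h₀⟩ := h.exists_bound_iteratedDeriv hT' 0
  obtain ⟨M₁, h₁⟩ := h.exists_bound_iteratedDeriv hT' p
  exact ⟨_, fun t ht => (h.smoothPeriodic ⟨ht.1, lt_of_le_of_lt ht.2 hT'⟩).decay_coef
    (fun x => by simpa using (h₀ t ht x).trans (le_max_left M₀ M₁))
    fun x => (h₁ t ht x).trans (le_max_right M₀ M₁)⟩

theorem IsSolution.transport_series (ha : 0 < a) (hg : 0 < g) (h : IsSolution a g T ρ₀ ρ) {t : ℝ}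
    (ht : t ∈ Ico 0 T) (x : ℝ) :
    ((-((g * H a (ρ t) x) * deriv (ρ t) x) : ℝ) : ℂ) = series (rhs (mult a g) (coef (ρ t))) x := by
  have hs := h.smoothPeriodic ht
  obtain ⟨M, hM⟩ := hs.exists_decay_coef 3
  have h1 := H_re_series (g := g) ha hs hM
    (fun y => by rw [← hs.eq_series, Complex.ofReal_re]) x
  have h2 := hs.deriv.eq_series x
  rw [hs.coef_deriv] at h2
  have h3 := series_mul ((hM.mono (q := 2) (by norm_num) le_rfl).vel (isMult_mult ha hg))
    (Decay.dx hM) x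
  rw [Complex.ofReal_neg, Complex.ofReal_mul, h1, h2, h3]
  simp only [series, rhs, neg_mul, tsum_neg]

theorem IsSolution.continuousOn_coef (h : IsSolution a g T ρ₀ ρ) {T' : ℝ} (hT' : T' < T) (k : ℤ) :
    ContinuousOn (fun t => coef (ρ t) k) (Icc 0 T') := by
  have hsub : ∀ t ∈ Icc 0 T', t ∈ Ico 0 T := fun t ht => ⟨ht.1, lt_of_le_of_lt ht.2 hT'⟩
  obtain ⟨M, hM⟩ := h.exists_bound_iteratedDeriv hT' 0
  refine continuousOn_const.mul fun t ht => ?_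
  refine intervalIntegral.continuousWithinAt_of_dominated_interval (bound := fun _ => M) ?_ ?_
    intervalIntegrable_const ?_
  · filter_upwards [self_mem_nhdsWithin] with r hr
    have h1 := (h.smoothPeriodic (hsub r hr)).smooth.continuous
    have h2 := continuous_ex (-k)
    exact (by fun_prop : Continuous fun x => ex (-k) x * (ρ r x : ℂ)).aestronglyMeasurable
  · filter_upwards [self_mem_nhdsWithin] with r hr
    refine Eventually.of_forall fun x _ => ?_
    rw [norm_mul, norm_ex, one_mul, Complex.norm_real]
    simpa using hM r hr x
  · refine Eventually.of_forall fun x _ => ?_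
    have h1 : ContinuousWithinAt (fun r => ρ r x) (Icc 0 T') t :=
      ((h.transport t (hsub t ht) x).continuousWithinAt).mono fun r hr => hsub r hr
    exact continuousWithinAt_const.mul (Complex.continuous_ofReal.continuousAt.comp_continuousWithinAt h1)

/-- Differentiate under the integral defining the coefficient; the time derivative is the series
with coefficients `rhs`, and uniqueness of coefficients identifies the result. -/
theorem IsSolution.hasDerivAt_coef (ha : 0 < a) (hg : 0 < g) (h : IsSolution a g T ρ₀ ρ) {t : ℝ}
    (ht : t ∈ Ioo 0 T) (k : ℤ) :
    HasDerivAt (fun t => coef (ρ t) k) (rhs (mult a g) (coef (ρ t)) k) t := by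
  obtain ⟨T', htT', hT'⟩ := exists_between ht.2
  have hμ := isMult_mult ha hg
  have hsub : ∀ r ∈ Ioo 0 T', r ∈ Ico 0 T := fun r hr => ⟨hr.1.le, hr.2.trans hT'⟩
  have hmem : Ioo 0 T' ∈ 𝓝 t := Ioo_mem_nhds ht.1 htT'
  -- 5 = 2 + 3: `rhs` loses three orders and must keep two for its series to be dominated.
  obtain ⟨M, hM⟩ := h.exists_decay hT' 5
  have hR : ∀ r ∈ Ioo 0 T', Decay 2 _ (rhs (mult a g) (coef (ρ r))) := fun r hr =>
    ((hM r (Ioo_subset_Icc_self hr)).mono (q := 2) (by norm_num) le_rfl).rhs hμ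
      (hM r (Ioo_subset_Icc_self hr))
  have htT : t ∈ Ioo 0 T' := ⟨ht.1, htT'⟩
  have hcont : ∀ r ∈ Ioo 0 T', Continuous fun x => ex (-k) x * (ρ r x : ℂ) := fun r hr => by
    have h1 := (h.smoothPeriodic (hsub r hr)).smooth.continuous
    have h2 := continuous_ex (-k)
    fun_prop
  have key := intervalIntegral.hasDerivAt_integral_of_dominated_loc_of_deriv_le
    (μ := volume) (a := 0) (b := 2 * Real.pi) (F := fun t x => ex (-k) x * (ρ t x : ℂ))
    (F' := fun t x => ex (-k) x * ((-((g * H a (ρ t) x) * deriv (ρ t) x) : ℝ) : ℂ))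
    (bound := fun _ => 6 * g * M * M * wtSum * wtSum) (x₀ := t) hmem
    (by filter_upwards [hmem] with r hr using (hcont r hr).aestronglyMeasurable)
    ((hcont t htT).intervalIntegrable _ _)
    (by
      simp only [h.transport_series ha hg (hsub t htT)]
      exact ((continuous_ex _).mul (continuous_series (hR t htT))).aestronglyMeasurable)
    (Eventually.of_forall fun x _ r hr => by
      rw [h.transport_series ha hg (hsub r hr), norm_mul, norm_ex, one_mul]
      exact norm_series_le (hR r hr) x)
    intervalIntegrable_const
    (Eventually.of_forall fun x _ r hr => by
      have := (h.transport r (hsub r hr) x).hasDerivAt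
        (Ico_mem_nhds hr.1 (hr.2.trans hT'))
      exact this.ofReal_comp.const_mul _)
  have h2 := key.2.const_mul (((2 * Real.pi : ℝ) : ℂ)⁻¹)
  have h3 := coef_series (hR t htT) (h.transport_series ha hg (hsub t htT))
  rw [← h3]
  exact h2

/-- Stability in `L²` of smooth solutions. -/
theorem IsSolution.sob_zero_sub_le (ha : 0 < a) (hg : 0 < g) {σ₀ : ℝ → ℝ} {σ : ℝ → ℝ → ℝ}
    (h : IsSolution a g T ρ₀ ρ) (h' : IsSolution a g T σ₀ σ) {t M : ℝ} (ht : t ∈ Ico 0 T)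
    (hM : ∀ r ∈ Icc 0 t, Decay 3 M (coef (ρ r))) (hM' : ∀ r ∈ Icc 0 t, Decay 3 M (coef (σ r))) :
    sob 0 (fun k => coef (ρ t) k - coef (σ t) k) ≤
      sob 0 (fun k => coef ρ₀ k - coef σ₀ k) * Real.exp (M * wtSum * (6 * g + 1) ^ 2 * t) := by
  rw [← h.initial, ← h'.initial]
  exact IPM.sob_zero_sub_le (T := t) (isMult_mult ha hg) hM hM' (h.continuousOn_coef ht.2)
    (h'.continuousOn_coef ht.2)
    (fun r hr k => h.hasDerivAt_coef ha hg ⟨hr.1, hr.2.trans ht.2⟩ k)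
    (fun r hr k => h'.hasDerivAt_coef ha hg ⟨hr.1, hr.2.trans ht.2⟩ k) t ⟨ht.1, le_rfl⟩

theorem IsSolution.eq_of_initial_eq (ha : 0 < a) (hg : 0 < g) {σ : ℝ → ℝ → ℝ}
    (h : IsSolution a g T ρ₀ ρ) (h' : IsSolution a g T ρ₀ σ) {t : ℝ} (ht : t ∈ Ico 0 T) :
    ρ t = σ t := by
  obtain ⟨M, hM⟩ := h.exists_decay ht.2 3
  obtain ⟨M', hM'⟩ := h'.exists_decay ht.2 3
  have key := h.sob_zero_sub_le ha hg h' ht (M := max M M')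
    (fun r hr => (hM r hr).mono le_rfl (le_max_left _ _))
    (fun r hr => (hM' r hr).mono le_rfl (le_max_right _ _))
  have htt : t ∈ Icc 0 t := ⟨ht.1, le_rfl⟩
  have hw : Decay 1 (M + M') (fun k => coef (ρ t) k - coef (σ t) k) :=
    ((hM t htt).sub (hM' t htt)).mono (by norm_num) le_rfl
  have h0 : sob 0 (fun k => coef ρ₀ k - coef ρ₀ k) = 0 := by simp [sob]
  rw [h0, zero_mul] at key
  have hcoef : coef (ρ t) = coef (σ t) := by
    funext k
    have h1 := (summable_norm_sq hw).le_tsum k fun _ _ => sq_nonneg _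
    rw [← sob_zero] at h1
    exact sub_eq_zero.1 (norm_eq_zero.1 (pow_eq_zero_iff two_ne_zero |>.1
      (le_antisymm (h1.trans key) (sq_nonneg _))))
  funext x
  have h1 := (h.smoothPeriodic ht).eq_series x
  rw [hcoef, ← (h'.smoothPeriodic ht).eq_series x] at h1
  exact_mod_cast h1

end

/-! ### Continuous dependence -/

theorem CkClose.mono {n m : ℕ} {δ ε : ℝ} {f h : ℝ → ℝ} (hc : CkClose n δ f h) (hm : m ≤ n)
    (hδ : δ ≤ ε) : CkClose m ε f h := fun j hj x => (hc j (hj.trans hm) x).trans hδ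

theorem CkClose.self {n : ℕ} {δ : ℝ} (hδ : 0 ≤ δ) (f : ℝ → ℝ) : CkClose n δ f f := fun j _ x => by
  simpa using hδ

theorem SmoothPeriodic.exists_decay_of_ckClose {h : ℝ → ℝ} (hh : SmoothPeriodic h) (n : ℕ) :
    ∃ C, ∀ f, SmoothPeriodic f → CkClose n 1 f h → Decay n C (coef f) := by
  obtain ⟨M₀, -, h₀⟩ := hh.exists_bound
  obtain ⟨M₁, -, h₁⟩ := (hh.iteratedDeriv n).exists_bound
  refine ⟨2 ^ n * (max M₀ M₁ + 1), fun f hf hc => hf.decay_coef (fun x => ?_) fun x => ?_⟩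
  · have h2 := hc 0 (Nat.zero_le _) x
    rw [iteratedDeriv_zero, iteratedDeriv_zero] at h2
    have h3 := abs_sub_abs_le_abs_sub (f x) (h x)
    linarith [h₀ x, le_max_left M₀ M₁]
  · have h2 := hc n le_rfl x
    have h3 := abs_sub_abs_le_abs_sub (_root_.iteratedDeriv n f x) (_root_.iteratedDeriv n h x)
    linarith [h₁ x, le_max_right M₀ M₁]

theorem SmoothPeriodic.iteratedDeriv_sub {f h : ℝ → ℝ} (hf : SmoothPeriodic f)
    (hh : SmoothPeriodic h) (j : ℕ) (x : ℝ) :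
    _root_.iteratedDeriv j (fun x => f x - h x) x =
      _root_.iteratedDeriv j f x - _root_.iteratedDeriv j h x :=
  iteratedDeriv_fun_sub (hf.smooth.contDiffAt.of_le (by exact_mod_cast le_top))
    (hh.smooth.contDiffAt.of_le (by exact_mod_cast le_top))

theorem decay_of_ckClose {f h : ℝ → ℝ} (hf : SmoothPeriodic f) (hh : SmoothPeriodic h) {η : ℝ}
    (hc : CkClose 1 η f h) : Decay 1 (2 * η) (fun k => coef f k - coef h k) := by
  have := (hf.sub hh).decay_coef (p := 1) (M := η) (fun x => by simpa using hc 0 zero_le_one x)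
    (fun x => by rw [hf.iteratedDeriv_sub hh]; exact hc 1 le_rfl x)
  rw [pow_one] at this
  intro k
  beta_reduce
  rw [← coef_sub hf.smooth.continuous hh.smooth.continuous]
  exact this k

theorem ckClose_of_decay {f h : ℝ → ℝ} (hf : SmoothPeriodic f) (hh : SmoothPeriodic h) {m : ℕ}
    {D ε : ℝ} (hD : Decay (m + 2) D (fun k => coef f k - coef h k)) (hε : D * wtSum ≤ ε) :
    CkClose m ε f h := by
  intro j hj x
  rw [← hf.iteratedDeriv_sub hh]
  refine (((hf.sub hh).iteratedDeriv j).abs_le (M := D) (fun k => ?_) x).trans hε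
  have := (hD.mono (q := 2 + j) (by omega) le_rfl).mul_left (m := fun k => (Complex.I * k) ^ j)
    zero_le_one (fun k => by
      rw [norm_pow, norm_mul, Complex.norm_I, one_mul, one_mul, Complex.norm_intCast]
      exact pow_le_pow_left₀ (abs_nonneg _) (abs_le_wt k) j) k
  rw [one_mul] at this
  rwa [(hf.sub hh).coef_iteratedDeriv, coef_sub hf.smooth.continuous hh.smooth.continuous]

/-- Geometric mean of a bound of twice the order and a bound of order 0: smallness of `q` is
inherited with a square root. -/
theorem decay_of_interpolation {m : ℕ} {P q : ℝ} {w : ℤ → ℂ} (hw : Decay (2 * (m + 2)) P w)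
    (hq : ∀ k, ‖w k‖ ≤ q) : Decay (m + 2) (√(P * q)) w := fun k => by
  refine Real.le_sqrt_of_sq_le ?_
  calc (wt k ^ (m + 2) * ‖w k‖) ^ 2 = (wt k ^ (2 * (m + 2)) * ‖w k‖) * ‖w k‖ := by ring
    _ ≤ P * q := mul_le_mul (hw k) (hq k) (norm_nonneg _) hw.nonneg

/-- `A` stands for a class of data whose solutions satisfy common bounds of every order on [0, T).
Those bounds supply the high norm, and L² stability supplies the small one. -/
theorem continuous_dependence {a g T : ℝ} (ha : 0 < a) (hg : 0 < g) {Φ : ℕ → ℝ → ℝ}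
    {A : (ℝ → ℝ) → Prop}
    (hΦ : ∀ σ₀ σ, A σ₀ → SmoothPeriodic σ₀ → IsSolution a g T σ₀ σ →
      ∀ s M, Decay (s + 1) M (coef σ₀) → ∀ t ∈ Ico 0 T, Decay s (Φ s M) (coef (σ t)))
    {σ₀ : ℝ → ℝ} {σ : ℝ → ℝ → ℝ} (hA : A σ₀) (hσ₀ : SmoothPeriodic σ₀)
    (hσ : IsSolution a g T σ₀ σ) (m : ℕ) {ε : ℝ} (hε : 0 < ε) :
    ∃ (n : ℕ) (η : ℝ), 0 < η ∧ ∀ (τ₀ : ℝ → ℝ) (τ : ℝ → ℝ → ℝ), A τ₀ → SmoothPeriodic τ₀ →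
      IsSolution a g T τ₀ τ → CkClose n η τ₀ σ₀ → ∀ t ∈ Ico 0 T, CkClose m ε (τ t) (σ t) := by
  set s := 2 * (m + 2) with hs
  obtain ⟨C, hC⟩ := hσ₀.exists_decay_of_ckClose (s + 1)
  set P := Φ s C with hP
  set κ := P * wtSum * (6 * g + 1) ^ 2 with hκ
  set Q := √(4 * wtSum * Real.exp (κ * T)) with hQ
  have hQ0 : 0 ≤ Q := Real.sqrt_nonneg _
  have hZ := wtSum_nonneg
  -- The bound 1 puts both data in one unit C^(s+1) ball, with a common constant `C`. The other is
  -- what interpolation requires, √(2P · ηQ) · `wtSum` ≤ ε; the + 1 avoids division by zero, and |P|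
  -- is used because P ≥ 0 is known only once some time in [0, T) is given.
  refine ⟨s + 1, min 1 (ε ^ 2 / ((2 * |P| * Q) * wtSum ^ 2 + 1)),
    lt_min one_pos (by positivity), fun τ₀ τ hAτ hτ₀ hτ hclose t ht => ?_⟩
  set η := min 1 (ε ^ 2 / ((2 * |P| * Q) * wtSum ^ 2 + 1)) with hη
  have hη0 : 0 < η := lt_min one_pos (by positivity)
  have hdσ := hΦ σ₀ σ hA hσ₀ hσ s C (hC σ₀ hσ₀ (CkClose.self zero_le_one σ₀))
  have hdτ := hΦ τ₀ τ hAτ hτ₀ hτ s C (hC τ₀ hτ₀ (hclose.mono le_rfl (min_le_left _ _)))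
  have hP0 : 0 ≤ P := (hdσ t ht).nonneg
  have hκ0 : 0 ≤ κ := by positivity
  have hsub : ∀ r ∈ Icc 0 t, r ∈ Ico 0 T := fun r hr => ⟨hr.1, lt_of_le_of_lt hr.2 ht.2⟩
  have hL2 := hτ.sob_zero_sub_le ha hg hσ ht (M := P)
    (fun r hr => (hdτ r (hsub r hr)).mono (by omega) le_rfl)
    (fun r hr => (hdσ r (hsub r hr)).mono (by omega) le_rfl)
  have h0 : sob 0 (fun k => coef τ₀ k - coef σ₀ k) ≤ (2 * η) ^ 2 * wtSum :=
    (decay_of_ckClose hτ₀ hσ₀ (hclose.mono (by omega) le_rfl)).sob_le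
  have hwdec : Decay s (P + P) (fun k => coef (τ t) k - coef (σ t) k) := (hdτ t ht).sub (hdσ t ht)
  have hwsmall : ∀ k, ‖coef (τ t) k - coef (σ t) k‖ ≤ η * Q := fun k => by
    have h1 := (summable_norm_sq (hwdec.mono (q := 1) (by omega) le_rfl)).le_tsum k
      fun _ _ => sq_nonneg _
    rw [← sob_zero] at h1
    refine le_of_abs_le (abs_le_of_sq_le_sq ((h1.trans hL2).trans ?_) (by positivity))
    rw [mul_pow, hQ, Real.sq_sqrt (by positivity)]
    calc _ ≤ (2 * η) ^ 2 * wtSum * Real.exp (κ * T) := by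
          gcongr
          exact ht.2.le
      _ = _ := by ring
  refine ckClose_of_decay (hτ.smoothPeriodic ht) (hσ.smoothPeriodic ht)
    (decay_of_interpolation hwdec hwsmall) ?_
  refine le_of_abs_le (abs_le_of_sq_le_sq ?_ hε.le)
  rw [mul_pow, Real.sq_sqrt (by positivity)]
  have h3 : η * ((2 * |P| * Q) * wtSum ^ 2 + 1) ≤ ε ^ 2 :=
    (le_div_iff₀ (by positivity)).1 (min_le_right _ _)
  rw [abs_of_nonneg hP0] at h3
  linarith

end IPM

/-! ### Well-posedness in the smooth class -/

theorem mainTheorem2 (a g : ℝ) (ha : 0 < a) (hg : 0 < g) :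
    -- uniqueness, on every common time interval
    (∀ (T : ℝ) (ρ₀ : ℝ → ℝ) (ρ₁ ρ₂ : ℝ → ℝ → ℝ), IPM.SmoothPeriodic ρ₀ →
      IPM.IsSolution a g T ρ₀ ρ₁ → IPM.IsSolution a g T ρ₀ ρ₂ →
      ∀ t ∈ Set.Ico 0 T, ρ₁ t = ρ₂ t) ∧
    -- local existence near every datum, and continuity of the solution map
    (∀ ρ₀ : ℝ → ℝ, IPM.SmoothPeriodic ρ₀ →
      ∃ T : ℝ, 0 < T ∧ ∃ (k : ℕ) (δ : ℝ), 0 < δ ∧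
        (∀ σ₀ : ℝ → ℝ, IPM.SmoothPeriodic σ₀ → IPM.CkClose k δ σ₀ ρ₀ →
          ∃ σ : ℝ → ℝ → ℝ, IPM.IsSolution a g T σ₀ σ) ∧
        (∀ (σ₀ : ℝ → ℝ) (σ : ℝ → ℝ → ℝ), IPM.SmoothPeriodic σ₀ → IPM.CkClose k δ σ₀ ρ₀ →
          IPM.IsSolution a g T σ₀ σ →
          ∀ (m : ℕ) (ε : ℝ), 0 < ε → ∃ (n : ℕ) (η : ℝ), 0 < η ∧
            ∀ (τ₀ : ℝ → ℝ) (τ : ℝ → ℝ → ℝ), IPM.SmoothPeriodic τ₀ → IPM.CkClose k δ τ₀ ρ₀ →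
              IPM.IsSolution a g T τ₀ τ → IPM.CkClose n η τ₀ σ₀ →
              ∀ t ∈ Set.Ico 0 T, IPM.CkClose m ε (τ t) (σ t))) := by
  refine ⟨fun T ρ₀ ρ₁ ρ₂ _ h₁ h₂ t ht => h₁.eq_of_initial_eq ha hg h₂ ht, fun ρ₀ hρ₀ => ?_⟩
  obtain ⟨R, hR⟩ := hρ₀.exists_decay_of_ckClose 3
  obtain ⟨T, hT, Φ, hex⟩ := IPM.exists_isSolution ha hg R
  -- The unit C³ neighbourhood bounds the order-3 decay constant of the data by `R`, the only
  -- quantity on which the lifespan depends once a and g are fixed.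
  refine ⟨T, hT, 3, 1, one_pos, fun σ₀ hσ₀ hc => ?_, fun σ₀ σ hσ₀ hc hσ m ε hε => ?_⟩
  · obtain ⟨σ, hσ, -⟩ := hex σ₀ hσ₀ (hR σ₀ hσ₀ hc)
    exact ⟨σ, hσ⟩
  · obtain ⟨n, η, hη, h⟩ := IPM.continuous_dependence (Φ := Φ)
      (A := fun σ₀ => IPM.CkClose 3 1 σ₀ ρ₀) ha hg
      (fun σ₀ σ hA hσ₀ hσ s M hM t ht => by
        -- The bounds are known for the constructed solution; uniqueness transfers them to an
        -- arbitrary one.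
        obtain ⟨σ', hσ', hbd⟩ := hex σ₀ hσ₀ (hR σ₀ hσ₀ hA)
        rw [hσ.eq_of_initial_eq ha hg hσ' ht]
        exact hbd s M hM t ht) hc hσ₀ hσ m hε
    exact ⟨n, η, hη, fun τ₀ τ hτ₀ hA hτ hclose => h τ₀ τ hA hτ₀ hτ hclose⟩
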